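/- A *translation surface* $S$ is a closed connected surface with a flat length metric that has finitely many cone points $p_1,\dots,p_n$, of cone angles $2\pi(k_i+1)$ with integers $k_i\ge 1$, together with an atlas of isometric charts to the Euclidean plane on the complement of the cone points whose transition maps are translations, such that in polar coordinates $(r,\theta)$ around each cone point the charts are, up to additive constants, given by $re^{i\theta}$. It lies in the *stratum* $\mathcal H(k_1,\dots,k_n)$ if its cone points can be numbered so that $p_i$ has cone angle $2\pi(k_i+1)$ for every $i$. Let $\operatorname{area}(S)$ be its area, let $\operatorname{sys}(S)$ be the infimum of the lengths of its simple closed geodesics (injective closed curves, parametrized by arc length, that are isometric embeddings near every parameter), let $\operatorname{sr}(S)=\operatorname{sys}(S)^2/\operatorname{area}(S)$ be its systolic ratio, and for $K=(k_1,\dots,k_n)$ let $$\operatorname{sr}(\mathcal H(K))=\sup\{\operatorname{sr}(S)\mid S\text{ a translation surface in }\mathcal H(K)\}.$$ **Theorem (area estimate).** 1. Let $n\ge 1$ and $K=(k_1,\dots,k_n)$ with $k_1\le k_2\le\dots\le k_n$. Then $$\operatorname{sr}(\mathcal H(K))\le\frac{4}{\pi\,(k_n+1)}.$$ 2. If a translation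 surface $S$ has a cone point of cone angle $2\pi k$, then $$\operatorname{sr}(S)\le\frac{4}{\pi k}.$$ -/

import Mathlib

open scoped Real Topology ENNReal MeasureTheory

universe u

noncomputable section

/-- The length of the curve `γ` restricted to `[a, b]` (supremum of the lengths of inscribed
polygonal chains). -/
def curveLength {X : Type u} [PseudoEMetricSpace X] (γ : ℝ → X) (a b : ℝ) : ℝ≥0∞ :=
  eVariationOn γ (Set.Icc a b)

/-- The metric of `X` is intrinsic: the distance of two points is the infimum of the lengths of
the curves that join them. (No curve is shorter than the distance of its endpoints, so only the
other inequality has to be required.) -/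
def IsLengthMetric (X : Type u) [MetricSpace X] : Prop :=
  ∀ x y : X, ∀ δ : ℝ, 0 < δ → ∃ γ : ℝ → X, ContinuousOn γ (Set.Icc 0 1) ∧
    γ 0 = x ∧ γ 1 = y ∧ curveLength γ 0 1 ≤ ENNReal.ofReal (dist x y + δ)

/-- The distance, in the Euclidean cone of total angle `2πm`, between the points with polar
coordinates `(r, θ)` and `(s, φ)`. The angular coordinate lives in `ℝ / 2πmℤ`, whose quotient norm
is the angular distance; this is the law of cosines when that distance is at most `π`, and `r + s`
otherwise. -/
def coneDist (m : ℕ) (r θ s φ : ℝ) : ℝ :=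
  √(r ^ 2 + s ^ 2 - 2 * r * s * Real.cos (min π ‖((θ - φ : ℝ) : AddCircle (2 * π * m))‖))

/-- The point of the plane with polar coordinates `(r, θ)`. -/
def polarPoint (r θ : ℝ) : ℂ := r * Complex.exp (θ * Complex.I)

/-- A translation surface: a closed connected surface with a flat length metric, finitely many
cone points of angles `2π(k + 1)`, `k ≥ 1`, and isometric charts to the plane off the cone points
with translations as transition maps. -/
structure TranslationSurface where
  /-- The points of the surface. -/
  carrier : Type u
  [metricSpace : MetricSpace carrier]
  [compactSpace : CompactSpace carrier]
  [connectedSpace : ConnectedSpace carrier]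
  isLengthMetric : IsLengthMetric carrier
  /-- The order `k` of a point; the total angle at the point is `2π(k + 1)`. The points of order
  `0` are the regular points, all others are the cone points. -/
  order : carrier → ℕ
  finite_conePoints : {p | order p ≠ 0}.Finite
  /-- The translation charts of the regular part. -/
  atlas : Set (OpenPartialHomeomorph carrier ℂ)
  /-- The charts cover the regular points, and no others. -/
  iUnion_source : ⋃ e ∈ atlas, e.source = {p | order p = 0}
  /-- The charts are local isometries. -/
  chart_isometry : ∀ e ∈ atlas, ∀ p ∈ e.source, ∃ U ∈ 𝓝 p, ∀ x ∈ U, ∀ y ∈ U,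
    dist (e x) (e y) = dist x y
  /-- Locally, the transition maps are translations. -/
  chart_translation : ∀ e ∈ atlas, ∀ e' ∈ atlas, ∀ p ∈ e.source ∩ e'.source,
    ∀ᶠ x in 𝓝 p, e' x - e' p = e x - e p
  /-- A small ball around a cone point `p` of order `k` is, in polar coordinates `ψ`, a ball around
  the vertex of the Euclidean cone of angle `2π(k + 1)`; off `p`, the translation charts read the
  point `ψ r θ` as the plane point with polar coordinates `(r, θ)`, up to a local constant. -/
  cone_chart : ∀ p, order p ≠ 0 → ∃ ε : ℝ, 0 < ε ∧ ∃ ψ : ℝ → ℝ → carrier,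
    (∀ θ, ψ 0 θ = p) ∧
    {x | ∃ r θ, 0 ≤ r ∧ r < ε ∧ ψ r θ = x} = Metric.ball p ε ∧
    (∀ r θ s φ, 0 ≤ r → r < ε → 0 ≤ s → s < ε →
      dist (ψ r θ) (ψ s φ) = coneDist (order p + 1) r θ s φ) ∧
    (∀ r θ, 0 < r → r < ε → ∀ e ∈ atlas, ψ r θ ∈ e.source →
      ∀ᶠ x : ℝ × ℝ in 𝓝 (r, θ),
        e (ψ x.1 x.2) - e (ψ r θ) = polarPoint x.1 x.2 - polarPoint r θ)

attribute [instance] TranslationSurface.metricSpace TranslationSurface.compactSpace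
  TranslationSurface.connectedSpace

namespace TranslationSurface

/-- The singularities of the flat metric. -/
def IsConePoint (S : TranslationSurface.{u}) (p : S.carrier) : Prop := S.order p ≠ 0

/-- The total angle at a point. -/
def coneAngle (S : TranslationSurface.{u}) (p : S.carrier) : ℝ := 2 * π * (S.order p + 1)

/-- The area of the surface: its two-dimensional Hausdorff measure, normalized to agree with
Lebesgue measure in the Euclidean plane. -/
def area (S : TranslationSurface.{u}) : ℝ≥0∞ :=
  letI : MeasurableSpace S.carrier := borel S.carrier
  haveI : BorelSpace S.carrier := ⟨rfl⟩
  (μHE[2] : MeasureTheory.Measure S.carrier) Set.univ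

/-- A simple closed geodesic of period `ℓ > 0`, as an `ℓ`-periodic map of the line: it is locally
an isometric embedding (at every parameter, so that it is geodesic also where it closes up), and it
is injective on a period. -/
structure IsSimpleClosedGeodesic (S : TranslationSurface.{u}) (γ : ℝ → S.carrier) (ℓ : ℝ) :
    Prop where
  period_pos : 0 < ℓ
  periodic : Function.Periodic γ ℓ
  locally_isometric : ∀ t, ∃ U ∈ 𝓝 t, ∀ x ∈ U, ∀ y ∈ U, dist (γ x) (γ y) = dist x y
  simple : Set.InjOn γ (Set.Ico 0 ℓ)

/-- The systole length: the infimum of the lengths of the simple closed geodesics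
(`∞` if there were none). -/
def sys (S : TranslationSurface.{u}) : ℝ≥0∞ :=
  ⨅ (γ : ℝ → S.carrier) (ℓ : ℝ) (_ : S.IsSimpleClosedGeodesic γ ℓ), curveLength γ 0 ℓ

/-- The systolic ratio. -/
def systolicRatio (S : TranslationSurface.{u}) : ℝ≥0∞ := S.sys ^ 2 / S.area

/-- `S` lies in the stratum `H(K 0, …, K (n - 1))`: its cone points can be numbered so that the
`i`-th one has order `K i`, that is, cone angle `2π(K i + 1)`. -/
def InStratum (S : TranslationSurface.{u}) {n : ℕ} (K : Fin n → ℕ) : Prop :=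
  ∃ p : Fin n ≃ {p : S.carrier // S.IsConePoint p}, ∀ i, S.order (p i) = K i

end TranslationSurface

/-- The supremal systolic ratio in the stratum `H(K 0, …, K (n - 1))`. -/
def stratumSystolicRatio {n : ℕ} (K : Fin n → ℕ) : ℝ≥0∞ :=
  ⨆ (S : TranslationSurface.{u}) (_ : S.InStratum K), S.systolicRatio

end

/-!
Let `p` be a cone point of angle `2πk`. The ball of radius `sys / 2` around `p` has at least the area
`πk (sys / 2) ^ 2` of the ball of this radius in the Euclidean cone of angle `2πk`, and the estimate
of the systolic ratio follows. Only two properties of the surface enter, besides the cone structure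
at `p`: it is locally nonpositively curved, in the sense of the inequality of Bruhat and Tits
(`coneDist_bruhatTits`), and shortest paths can locally be continued (`HasLocalExtensions`).

*Shortest paths of length less than `sys / 2` are unique.* Call two distinct shortest paths with the
same endpoints a bigon. By nonpositive curvature, the distance of two uniformly close local geodesics
is a convex function of the parameter (`NonposCurvedAtScale.dist_le_of_isLocalGeodesic`), so shortest
paths with common endpoints are isolated. Hence, by compactness, if there are bigons at all, there is
a shortest one. Its sides meet only at the endpoints, and it has no corners: at a corner, a continuous
family of shortest paths would lead from one side to the other, and produce a third shortest path
that is too close to one of the sides (`NonposCurvedAtScale.exists_dist_symm_eq`). So a shortest bigon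
is a simple closed geodesic, and its sides have at least the length `sys / 2`
(`TranslationSurface.uniqueShortestPaths_of_le_sys`).

*Areas of balls.* Let `r ≤ sys / 2`. Shortest paths from `p` can be extended to any length less than
`r` (`NonposCurvedAtScale.exists_long_extension`), so the contraction of the ball of radius `r` towards
`p` by a factor `t` is onto the ball of radius `t * r`. By convexity it is locally `t`-Lipschitz, so it
multiplies areas by `t ^ 2` at most (`NonposCurvedAtScale.area_ball_mul_le`). For small `t`, the image
is a ball of a Euclidean cone, which contains `k` disjoint slit discs
(`TranslationSurface.le_area_ball`).
-/

open scoped unitInterval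

/-! ### Shortest paths in compact length spaces -/

/-- The shortest paths of `X`, parametrized by the unit interval with constant speed. -/
def shortestPaths (X : Type u) [MetricSpace X] : Set C(I, X) :=
  {c | ∀ s t : I, dist (c s) (c t) = dist (c 0) (c 1) * |(s : ℝ) - t|}

section ShortestPaths

variable {X : Type u} [MetricSpace X]

theorem dist_zero_of_mem_shortestPaths {c : C(I, X)} (hc : c ∈ shortestPaths X) (t : I) :
    dist (c 0) (c t) = dist (c 0) (c 1) * t := by
  rw [hc 0 t]; simp [abs_of_nonneg t.2.1]

theorem dist_one_of_mem_shortestPaths {c : C(I, X)} (hc : c ∈ shortestPaths X) (t : I) :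
    dist (c t) (c 1) = dist (c 0) (c 1) * (1 - t) := by
  rw [hc t 1, abs_sub_comm]; simp [abs_of_nonneg (sub_nonneg.2 t.2.2)]

/-- The restriction of a path to the interval from `u` to `v` (run backwards if `v < u`),
reparametrized linearly. -/
def subpath (c : C(I, X)) (u v : I) : C(I, X) where
  toFun t := c ⟨(1 - t) * u + t * v,
    (convex_Icc (0 : ℝ) 1) u.2 v.2 (sub_nonneg.2 t.2.2) t.2.1 (by ring)⟩
  continuous_toFun := by fun_prop

theorem subpath_apply (c : C(I, X)) (u v t w : I) (h : (w : ℝ) = (1 - t) * u + t * v) :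
    subpath c u v t = c w :=
  congrArg c (Subtype.ext h.symm)

@[simp] theorem subpath_zero (c : C(I, X)) (u v : I) : subpath c u v 0 = c u :=
  subpath_apply c u v 0 u (by simp)

@[simp] theorem subpath_one (c : C(I, X)) (u v : I) : subpath c u v 1 = c v :=
  subpath_apply c u v 1 v (by simp)

theorem subpath_mem_shortestPaths {c : C(I, X)} (hc : c ∈ shortestPaths X) (u v : I) :
    subpath c u v ∈ shortestPaths X := by
  intro s t
  rw [subpath_zero, subpath_one]
  change dist (c _) (c _) = _
  rw [hc, hc u v, mul_assoc, ← abs_mul, abs_sub_comm]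
  congr 2
  push_cast
  ring

theorem isCompact_shortestPaths [CompactSpace X] : IsCompact (shortestPaths X) := by
  apply ArzelaAscoli.isCompact_of_equicontinuous
  · have h : ContinuousMap.toFun '' shortestPaths X =
        {f : I → X | ∀ s t : I, dist (f s) (f t) = dist (f 0) (f 1) * |(s : ℝ) - t|} := by
      ext f
      constructor
      · rintro ⟨c, hc, rfl⟩
        exact hc
      · intro hf
        refine ⟨⟨f, ?_⟩, hf, rfl⟩
        refine (LipschitzWith.of_dist_le_mul (K := ⟨dist (f 0) (f 1), dist_nonneg⟩)
          fun s t => ?_).continuous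
        exact (hf s t).le
    rw [h]
    refine IsClosed.isCompact ?_
    simp only [Set.ofPred_forall]
    refine isClosed_iInter fun s => isClosed_iInter fun t => isClosed_eq ?_ ?_ <;> fun_prop
  · refine Metric.equicontinuous_of_continuity_modulus
      (fun r => Metric.diam (Set.univ : Set X) * r) ?_ _ ?_
    · have : ContinuousAt (fun r : ℝ => Metric.diam (Set.univ : Set X) * r) 0 := by fun_prop
      simpa [ContinuousAt] using this
    · intro s t c
      rw [c.2 s t]
      exact mul_le_mul_of_nonneg_right
        (Metric.dist_le_diam_of_mem isCompact_univ.isBounded trivial trivial) (abs_nonneg _)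

/-- On a path of length at most `dist x y + δ`, the first points at distance `τ * dist x y` from
`x` form a family that moves with unit speed up to `δ`. -/
theorem exists_almost_shortest (hX : IsLengthMetric X) (x y : X) {δ : ℝ} (hδ : 0 < δ) :
    ∃ f : I → X, f 0 = x ∧ dist (f 1) y ≤ δ ∧
      ∀ s t : I, dist (f s) (f t) ≤ dist x y * |(s : ℝ) - t| + δ := by
  obtain ⟨γ, hγ, h0, h1, hlen⟩ := hX x y δ hδ
  set A : ℝ → Set ℝ := fun τ => {t ∈ Set.Icc (0 : ℝ) 1 | τ * dist x y ≤ dist x (γ t)} with hA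
  have hAc : ∀ τ, IsCompact (A τ) := fun τ =>
    isCompact_Icc.of_isClosed_subset
      (ContinuousOn.preimage_isClosed_of_isClosed (f := fun t => dist x (γ t)) (by fun_prop)
        isClosed_Icc isClosed_Ici) fun t ht => ht.1
  have hAne : ∀ τ : I, (A τ).Nonempty := fun τ =>
    ⟨1, ⟨zero_le_one, le_rfl⟩, by
      rw [h1]; exact mul_le_of_le_one_left dist_nonneg τ.2.2⟩
  have hmem : ∀ τ : I, sInf (A τ) ∈ A τ := fun τ => (hAc τ).sInf_mem (hAne τ)
  have hdist : ∀ τ : I, dist x (γ (sInf (A τ))) = τ * dist x y := by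
    intro τ
    refine le_antisymm ?_ (hmem τ).2
    by_contra! hlt
    have hIcc := (hmem τ).1
    -- the intermediate value theorem gives an earlier point of `A τ`
    obtain ⟨t, ht, hte⟩ : τ * dist x y ∈ (fun t => dist x (γ t)) '' Set.Icc 0 (sInf (A τ)) := by
      refine intermediate_value_Icc hIcc.1 ?_ ⟨?_, hlt.le⟩
      · exact ((continuous_const.dist continuous_id).comp_continuousOn'
          (hγ.mono (Set.Icc_subset_Icc_right hIcc.2)))
      · simpa [h0] using mul_nonneg τ.2.1 dist_nonneg
    have hle : sInf (A τ) ≤ t := csInf_le (hAc τ).bddBelow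
      ⟨⟨ht.1, ht.2.trans hIcc.2⟩, hte.ge⟩
    have : t = sInf (A τ) := le_antisymm ht.2 hle
    subst this
    exact hlt.ne' hte
  have hmono : ∀ s t : I, (s : ℝ) ≤ t → sInf (A s) ≤ sInf (A t) := fun s t hst =>
    csInf_le_csInf (hAc s).bddBelow (hAne t) fun a ha =>
      ⟨ha.1, (mul_le_mul_of_nonneg_right hst dist_nonneg).trans ha.2⟩
  have hsum : ∀ a b : ℝ, 0 ≤ a → a ≤ b → b ≤ 1 →
      dist x (γ a) + dist (γ a) (γ b) + dist (γ b) y ≤ dist x y + δ := by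
    intro a b ha hab hb
    have e1 : edist (γ 0) (γ a) + edist (γ a) (γ b) + edist (γ b) (γ 1) ≤
        eVariationOn γ (Set.Icc 0 1) := by
      have q1 := eVariationOn.Icc_add_Icc γ (s := Set.univ) ha (hab.trans hb) trivial
      have q2 := eVariationOn.Icc_add_Icc γ (s := Set.univ) hab hb trivial
      simp only [Set.univ_inter] at q1 q2
      rw [← q1, ← q2, ← add_assoc]
      gcongr
      · exact eVariationOn.edist_le γ ⟨le_rfl, ha⟩ ⟨ha, le_rfl⟩
      · exact eVariationOn.edist_le γ ⟨le_rfl, hab⟩ ⟨hab, le_rfl⟩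
      · exact eVariationOn.edist_le γ ⟨le_rfl, hb⟩ ⟨hb, le_rfl⟩
    have e2 := e1.trans hlen
    rw [edist_dist, edist_dist, edist_dist, ← ENNReal.ofReal_add dist_nonneg dist_nonneg,
      ← ENNReal.ofReal_add (by positivity) dist_nonneg,
      ENNReal.ofReal_le_ofReal_iff (by positivity), h0, h1] at e2
    exact e2
  have key : ∀ s t : I, (s : ℝ) ≤ t →
      dist (γ (sInf (A s))) (γ (sInf (A t))) ≤ dist x y * |(s : ℝ) - t| + δ := by
    intro s t hst
    have := hsum _ _ (hmem s).1.1 (hmono s t hst) (hmem t).1.2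
    have h3 := dist_triangle x (γ (sInf (A t))) y
    rw [hdist] at h3
    rw [hdist] at this
    rw [abs_sub_comm, abs_of_nonneg (sub_nonneg.2 hst)]
    nlinarith
  refine ⟨fun τ => γ (sInf (A τ)), ?_, ?_, ?_⟩
  · have := hdist 0
    simp only [Set.Icc.coe_zero, zero_mul, dist_eq_zero] at this
    simpa using this.symm
  · have := hsum _ 1 (hmem 1).1.1 (hmem 1).1.2 le_rfl
    rw [hdist, h1, dist_self] at this
    simp only [Set.Icc.coe_one, one_mul] at this
    simp only [Set.Icc.coe_one] at *
    linarith
  · intro s t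
    rcases le_total (s : ℝ) t with hst | hst
    · exact key s t hst
    · rw [dist_comm, abs_sub_comm]
      exact key t s hst

/-- In a compact length space, any two points are joined by a shortest path. -/
theorem exists_shortestPath [CompactSpace X] (hX : IsLengthMetric X) (x y : X) :
    ∃ c ∈ shortestPaths X, c 0 = x ∧ c 1 = y := by
  set K : ℕ → Set (I → X) := fun n => {f | f 0 = x ∧ dist (f 1) y ≤ 1 / ((n : ℝ) + 1) ∧
      ∀ s t : I, dist (f s) (f t) ≤ dist x y * |(s : ℝ) - t| + 1 / ((n : ℝ) + 1)} with hK
  have hclosed : ∀ n, IsClosed (K n) := by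
    intro n
    have q1 : IsClosed {f : I → X | f 0 = x} := isClosed_eq (by fun_prop) (by fun_prop)
    have q2 : IsClosed {f : I → X | dist (f 1) y ≤ 1 / ((n : ℝ) + 1)} :=
      isClosed_le (by fun_prop) (by fun_prop)
    have q3 : IsClosed {f : I → X |
        ∀ s t : I, dist (f s) (f t) ≤ dist x y * |(s : ℝ) - t| + 1 / ((n : ℝ) + 1)} := by
      simp only [Set.ofPred_forall]
      refine isClosed_iInter fun s => isClosed_iInter fun t => isClosed_le ?_ ?_ <;> fun_prop
    exact q1.inter (q2.inter q3)
  obtain ⟨f, hf⟩ := IsCompact.nonempty_iInter_of_sequence_nonempty_isCompact_isClosed K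
    (fun n f hf => by
      have h1 : 1 / (((n + 1 : ℕ) : ℝ) + 1) ≤ 1 / ((n : ℝ) + 1) := by
        push_cast
        gcongr
        linarith
      exact ⟨hf.1, hf.2.1.trans h1, fun s t => (hf.2.2 s t).trans (by gcongr)⟩)
    (fun n => exists_almost_shortest hX x y Nat.one_div_pos_of_nat)
    (hclosed 0).isCompact hclosed
  simp only [Set.mem_iInter] at hf
  have hlim : Filter.Tendsto (fun n : ℕ => 1 / ((n : ℝ) + 1)) Filter.atTop (𝓝 0) :=
    tendsto_one_div_add_atTop_nhds_zero_nat
  have h0 : f 0 = x := (hf 0).1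
  have h1 : f 1 = y := by
    have h : dist (f 1) y ≤ 0 := ge_of_tendsto' hlim fun n => (hf n).2.1
    exact dist_le_zero.1 h
  have hle : ∀ s t : I, dist (f s) (f t) ≤ dist x y * |(s : ℝ) - t| := by
    intro s t
    have h := hlim.const_add (dist x y * |(s : ℝ) - t|)
    rw [add_zero] at h
    exact ge_of_tendsto' h fun n => (hf n).2.2 s t
  have key : ∀ s t : I, (s : ℝ) ≤ t → dist (f s) (f t) = dist x y * |(s : ℝ) - t| := by
    intro s t hst
    refine le_antisymm (hle s t) ?_
    have a1 := hle 0 s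
    have a2 := hle t 1
    have a3 := dist_triangle4 (f 0) (f s) (f t) (f 1)
    rw [abs_sub_comm] at a1 a2 ⊢
    rw [abs_of_nonneg (sub_nonneg.2 hst)]
    rw [abs_of_nonneg (by simpa using s.2.1)] at a1
    rw [abs_of_nonneg (by simpa using t.2.2)] at a2
    rw [h0, h1] at a3
    simp only [Set.Icc.coe_zero, Set.Icc.coe_one, h0, h1] at a1 a2
    linarith
  have keq : ∀ s t : I, dist (f s) (f t) = dist x y * |(s : ℝ) - t| := by
    intro s t
    rcases le_total (s : ℝ) t with hst | hst
    · exact key s t hst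
    · rw [dist_comm, abs_sub_comm]
      exact key t s hst
  refine ⟨⟨f, ?_⟩, ?_, h0, h1⟩
  · exact (LipschitzWith.of_dist_le_mul (K := ⟨dist x y, dist_nonneg⟩)
      fun s t => (keq s t).le).continuous
  · intro s t
    change dist (f s) (f t) = dist (f 0) (f 1) * _
    rw [h0, h1, keq]

theorem exists_midpoint [CompactSpace X] (hX : IsLengthMetric X) (x y : X) :
    ∃ m, dist x m = dist x y / 2 ∧ dist m y = dist x y / 2 := by
  obtain ⟨c, hc, rfl, rfl⟩ := exists_shortestPath hX x y
  refine ⟨c ⟨1 / 2, by norm_num, by norm_num⟩, ?_, ?_⟩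
  · rw [dist_zero_of_mem_shortestPaths hc]
    ring
  · rw [dist_one_of_mem_shortestPaths hc]
    ring

/-- If a shortest path is the only one between its endpoints, then shortest paths with nearby
endpoints are uniformly close to it. -/
theorem exists_forall_dist_lt_of_unique [CompactSpace X] {c : C(I, X)}
    (huniq : ∀ c' ∈ shortestPaths X, c' 0 = c 0 → c' 1 = c 1 → c' = c) {η : ℝ} (hη : 0 < η) :
    ∃ δ > 0, ∀ c' ∈ shortestPaths X, dist (c' 0) (c 0) < δ → dist (c' 1) (c 1) < δ →
      dist c' c < η := by
  have hcl : IsClosed {c' : C(I, X) | η ≤ dist c' c} := isClosed_le (by fun_prop) (by fun_prop)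
  have hcomp : IsCompact {c' ∈ shortestPaths X | η ≤ dist c' c} :=
    isCompact_shortestPaths.inter_right hcl
  have himg := hcomp.image (f := fun c' : C(I, X) => ((c' 0, c' 1) : X × X)) (by fun_prop)
  have hnot : (c 0, c 1) ∈ ((fun c' : C(I, X) => ((c' 0, c' 1) : X × X)) ''
      {c' ∈ shortestPaths X | η ≤ dist c' c})ᶜ := by
    rintro ⟨c', ⟨hc', hd⟩, he⟩
    rw [Prod.mk.injEq] at he
    rw [huniq c' hc' he.1 he.2, dist_self] at hd
    exact hη.not_ge hd
  obtain ⟨δ, hδ, hball⟩ := Metric.isOpen_iff.1 himg.isClosed.isOpen_compl _ hnot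
  refine ⟨δ, hδ, fun c' hc' h0 h1 => ?_⟩
  by_contra! hd
  have hmem : (c' 0, c' 1) ∈ Metric.ball (c 0, c 1) δ := by
    rw [Metric.mem_ball, Prod.dist_eq]
    exact max_lt h0 h1
  exact hball hmem ⟨c', ⟨hc', hd⟩, rfl⟩

end ShortestPaths

/-! ### Nonpositive curvature and convexity of the distance of geodesics -/

/-- Nonpositive curvature at scale `η`, in the form of the inequality of Bruhat and Tits: in balls
of radius `η`, the distance of `x` to the midpoint `m` of `y` and `z` is at most what it would be in
the Euclidean plane. -/
def NonposCurvedAtScale (X : Type u) [MetricSpace X] (η : ℝ) : Prop :=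
  ∀ q x y z m : X, x ∈ Metric.ball q η → y ∈ Metric.ball q η → z ∈ Metric.ball q η →
    m ∈ Metric.ball q η → dist y m = dist y z / 2 → dist m z = dist y z / 2 →
    dist x m ^ 2 ≤ dist x y ^ 2 / 2 + dist x z ^ 2 / 2 - dist y z ^ 2 / 4

/-- A curve that has locally, at all parameters inside of `[0, 1]`, constant speed `v` and shortest
length. -/
def IsLocalGeodesic {X : Type u} [MetricSpace X] (f : ℝ → X) (v : ℝ) : Prop :=
  ∀ t ∈ Set.Ioo (0 : ℝ) 1, ∃ δ > 0, ∀ a b, |a - t| ≤ δ → |b - t| ≤ δ →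
    dist (f a) (f b) = v * |a - b|

/-- A maximum principle: a function that is at most the average of its values at some two points
symmetric to `t`, for every interior `t`, attains its maximum at an endpoint. -/
theorem nonpos_of_le_average {u : ℝ → ℝ} (hu : ContinuousOn u (Set.Icc 0 1)) (h0 : u 0 ≤ 0)
    (h1 : u 1 ≤ 0) (h : ∀ t ∈ Set.Ioo (0 : ℝ) 1, ∃ ε > 0, t - ε ∈ Set.Icc (0 : ℝ) 1 ∧
      t + ε ∈ Set.Icc (0 : ℝ) 1 ∧ u t ≤ (u (t - ε) + u (t + ε)) / 2) :
    ∀ t ∈ Set.Icc (0 : ℝ) 1, u t ≤ 0 := by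
  by_contra! hpos
  obtain ⟨t₁, ht₁, hpos⟩ := hpos
  obtain ⟨t₂, ht₂, hmax⟩ := isCompact_Icc.exists_isMaxOn ⟨t₁, ht₁⟩ hu
  have hM : 0 < u t₂ := hpos.trans_le (hmax ht₁)
  -- the first point at which the maximum is attained cannot be in the interior
  have hcl : IsCompact (Set.Icc (0 : ℝ) 1 ∩ u ⁻¹' {u t₂}) :=
    isCompact_Icc.of_isClosed_subset
      (hu.preimage_isClosed_of_isClosed isClosed_Icc isClosed_singleton) Set.inter_subset_left
  obtain ⟨t, ⟨ht, hut⟩, hmin⟩ := hcl.exists_isLeast ⟨t₂, ht₂, rfl⟩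
  rw [Set.mem_preimage, Set.mem_singleton_iff] at hut
  have htpos : 0 < t := lt_of_le_of_ne ht.1 fun h => by rw [← hut, ← h] at hM; linarith
  have htlt : t < 1 := lt_of_le_of_ne ht.2 fun h => by rw [← hut, h] at hM; linarith
  obtain ⟨ε, hε, hl, hr, hav⟩ := h t ⟨htpos, htlt⟩
  have b1 : u (t + ε) ≤ u t₂ := hmax hr
  have b2 : u (t - ε) ≤ u t₂ := hmax hl
  have b3 : u (t - ε) = u t₂ := by linarith
  have := hmin ⟨hl, b3⟩
  linarith

section Curvature

variable {X : Type u} [MetricSpace X] {η : ℝ}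

/-- In a triangle with the vertices `x`, `y` and `z`, the segment that joins the midpoints of two
sides has at most half the length of the third one. -/
theorem NonposCurvedAtScale.dist_midpoints_triangle (hη : NonposCurvedAtScale X η)
    {q x y z m m' : X} (hx : x ∈ Metric.ball q η) (hy : y ∈ Metric.ball q η)
    (hz : z ∈ Metric.ball q η) (hm : m ∈ Metric.ball q η) (hm' : m' ∈ Metric.ball q η)
    (h1 : dist x m = dist x y / 2) (h2 : dist m y = dist x y / 2)
    (h3 : dist x m' = dist x z / 2) (h4 : dist m' z = dist x z / 2) :
    dist m m' ≤ dist y z / 2 := by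
  have a1 := hη q m' x y m hm' hx hy hm h1 h2
  have a2 := hη q y x z m' hy hx hz hm' h3 h4
  rw [dist_comm m' x, h3] at a1
  rw [dist_comm y m', dist_comm y x] at a2
  rw [dist_comm m' m] at a1
  have : dist m m' ^ 2 ≤ (dist y z / 2) ^ 2 := by nlinarith
  exact (pow_le_pow_iff_left₀ dist_nonneg (by positivity) two_ne_zero).1 this

/-- The midpoint form of the convexity of the distance of two segments, from the two triangles into
which a diagonal divides the quadrilateral of their endpoints. -/
theorem NonposCurvedAtScale.dist_midpoints [CompactSpace X] (hη : NonposCurvedAtScale X η)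
    (hX : IsLengthMetric X) {q y m z y' m' z' : X}
    (hy : y ∈ Metric.ball q (η / 3)) (hm : m ∈ Metric.ball q (η / 3))
    (hz : z ∈ Metric.ball q (η / 3)) (hy' : y' ∈ Metric.ball q (η / 3))
    (hm' : m' ∈ Metric.ball q (η / 3)) (hz' : z' ∈ Metric.ball q (η / 3))
    (h1 : dist y m = dist y z / 2) (h2 : dist m z = dist y z / 2)
    (h3 : dist y' m' = dist y' z' / 2) (h4 : dist m' z' = dist y' z' / 2) :
    dist m m' ≤ (dist y y' + dist z z') / 2 := by
  obtain ⟨n, hn1, hn2⟩ := exists_midpoint hX y z'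
  have hη0 : 0 < η := by linarith [Metric.pos_of_mem_ball hy]
  have hsub : Metric.ball q (η / 3) ⊆ Metric.ball q η :=
    Metric.ball_subset_ball (by linarith)
  have hn : n ∈ Metric.ball q η := by
    rw [Metric.mem_ball] at *
    have := dist_triangle n y q
    have := dist_triangle_right y z' q
    rw [dist_comm n y] at *
    linarith
  have e1 := hη.dist_midpoints_triangle (hsub hy) (hsub hz) (hsub hz') (hsub hm) hn h1 h2 hn1 hn2
  have e2 := hη.dist_midpoints_triangle (hsub hz') (hsub hy) (hsub hy') hn (hsub hm')
    (by rw [dist_comm z' n, dist_comm z' y, hn2]) (by rw [dist_comm n y, dist_comm z' y, hn1])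
    (by rw [dist_comm z' m', dist_comm z' y', h4]) (by rw [dist_comm m' y', dist_comm z' y', h3])
  linarith [dist_triangle m n m']

theorem IsLocalGeodesic.midpoint {f : ℝ → X} {v : ℝ} (hf : IsLocalGeodesic f v) {t : ℝ}
    (ht : t ∈ Set.Ioo (0 : ℝ) 1) : ∃ δ > 0, ∀ h, 0 ≤ h → h ≤ δ →
      dist (f (t - h)) (f t) = dist (f (t - h)) (f (t + h)) / 2 ∧
      dist (f t) (f (t + h)) = dist (f (t - h)) (f (t + h)) / 2 := by
  obtain ⟨δ, hδ, hd⟩ := hf t ht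
  refine ⟨δ, hδ, fun h h0 hh => ?_⟩
  have e0 : |t - t| ≤ δ := by simpa using hδ.le
  have e1 : |t - h - t| ≤ δ := by
    rw [show t - h - t = -h by ring, abs_neg, abs_of_nonneg h0]
    exact hh
  have e2 : |t + h - t| ≤ δ := by
    rw [show t + h - t = h by ring, abs_of_nonneg h0]
    exact hh
  rw [hd _ _ e1 e0, hd _ _ e1 e2, hd _ _ e0 e2, show t - h - t = -h by ring,
    show t - h - (t + h) = -(2 * h) by ring, show t - (t + h) = -h by ring, abs_neg, abs_neg,
    abs_of_nonneg h0, abs_of_nonneg (by positivity : 0 ≤ 2 * h)]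
  constructor <;> ring

/-- In nonpositive curvature, the distance between two uniformly close local geodesics is a convex
function of the parameter. -/
theorem NonposCurvedAtScale.dist_le_of_isLocalGeodesic [CompactSpace X]
    (hη : NonposCurvedAtScale X η) (hX : IsLengthMetric X) {f g : ℝ → X} {v w : ℝ}
    (hfc : ContinuousOn f (Set.Icc 0 1)) (hgc : ContinuousOn g (Set.Icc 0 1))
    (hf : IsLocalGeodesic f v) (hg : IsLocalGeodesic g w)
    (hfg : ∀ t ∈ Set.Icc (0 : ℝ) 1, dist (f t) (g t) < η / 3) :
    ∀ t ∈ Set.Icc (0 : ℝ) 1,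
      dist (f t) (g t) ≤ (1 - t) * dist (f 0) (g 0) + t * dist (f 1) (g 1) := by
  intro t ht
  refine sub_nonpos.1 (nonpos_of_le_average (u := fun t => dist (f t) (g t) -
    ((1 - t) * dist (f 0) (g 0) + t * dist (f 1) (g 1))) (by fun_prop) (by simp) (by simp) ?_ t ht)
  clear ht t
  intro t ht
  have hIcc := Set.Ioo_subset_Icc_self ht
  obtain ⟨δ₁, hδ₁, h₁⟩ := hf.midpoint ht
  obtain ⟨δ₂, hδ₂, h₂⟩ := hg.midpoint ht
  have hη0 : 0 < η := by linarith [dist_nonneg.trans_lt (hfg t hIcc)]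
  have hnhds : Set.Icc (0 : ℝ) 1 ∈ 𝓝 t := Icc_mem_nhds ht.1 ht.2
  have c1 : ∀ᶠ s in 𝓝 t, f s ∈ Metric.ball (f t) (η / 3) :=
    (hfc.continuousAt hnhds).eventually_mem (Metric.ball_mem_nhds _ (by positivity))
  have c2 : ∀ᶠ s in 𝓝 t, g s ∈ Metric.ball (f t) (η / 3) :=
    (hgc.continuousAt hnhds).eventually_mem (Metric.isOpen_ball.mem_nhds (by
      rw [Metric.mem_ball, dist_comm]; exact hfg t hIcc))
  obtain ⟨δ₃, hδ₃, h₃⟩ := Metric.eventually_nhds_iff.1 (c1.and (c2.and hnhds))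
  set ε := min (min δ₁ δ₂) (δ₃ / 2) with hε
  have hε0 : 0 < ε := by positivity
  have hεδ₃ : ε < δ₃ := (min_le_right _ _).trans_lt (by linarith)
  have hl := @h₃ (t - ε) (by simpa [Real.dist_eq, abs_of_pos hε0] using hεδ₃)
  have hr := @h₃ (t + ε) (by simpa [Real.dist_eq, abs_of_pos hε0] using hεδ₃)
  have hc := @h₃ t (by simpa using hδ₃)
  have k₁ := h₁ ε hε0.le ((min_le_left _ _).trans (min_le_left _ _))
  have k₂ := h₂ ε hε0.le ((min_le_left _ _).trans (min_le_right _ _))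
  refine ⟨ε, hε0, hl.2.2, hr.2.2, ?_⟩
  have := hη.dist_midpoints hX hl.1 hc.1 hr.1 hl.2.1 hc.2.1 hr.2.1 k₁.1 k₁.2 k₂.1 k₂.2
  linarith

theorem isLocalGeodesic_IccExtend {c : C(I, X)} (hc : c ∈ shortestPaths X) :
    IsLocalGeodesic (Set.IccExtend zero_le_one c) (dist (c 0) (c 1)) := by
  intro t ht
  refine ⟨min t (1 - t), lt_min ht.1 (sub_pos.2 ht.2), fun a b ha hb => ?_⟩
  rw [le_min_iff, abs_le, abs_le] at ha hb
  have ha' : a ∈ Set.Icc (0 : ℝ) 1 := ⟨by linarith, by linarith⟩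
  have hb' : b ∈ Set.Icc (0 : ℝ) 1 := ⟨by linarith, by linarith⟩
  rw [Set.IccExtend_of_mem _ _ ha', Set.IccExtend_of_mem _ _ hb']
  exact hc _ _

theorem NonposCurvedAtScale.dist_le_of_mem_shortestPaths [CompactSpace X]
    (hη : NonposCurvedAtScale X η) (hX : IsLengthMetric X) {c c' : C(I, X)}
    (hc : c ∈ shortestPaths X) (hc' : c' ∈ shortestPaths X) (hd : dist c c' < η / 3) (t : I) :
    dist (c t) (c' t) ≤ (1 - t) * dist (c 0) (c' 0) + t * dist (c 1) (c' 1) := by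
  have := hη.dist_le_of_isLocalGeodesic hX (c.continuous.Icc_extend').continuousOn
    (c'.continuous.Icc_extend').continuousOn (isLocalGeodesic_IccExtend hc)
    (isLocalGeodesic_IccExtend hc') (fun t ht => ?_) t t.2
  · simpa [Set.IccExtend_of_mem _ _ t.2] using this
  · rw [Set.IccExtend_of_mem _ _ ht, Set.IccExtend_of_mem _ _ ht]
    exact (ContinuousMap.dist_apply_le_dist _).trans_lt hd

/-- In nonpositive curvature, shortest paths with the same endpoints are isolated. -/
theorem NonposCurvedAtScale.eq_of_dist_lt [CompactSpace X]
    (hη : NonposCurvedAtScale X η) (hX : IsLengthMetric X) {c c' : C(I, X)}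
    (hc : c ∈ shortestPaths X) (hc' : c' ∈ shortestPaths X) (hd : dist c c' < η / 3)
    (h0 : c 0 = c' 0) (h1 : c 1 = c' 1) : c = c' := by
  ext t
  have := hη.dist_le_of_mem_shortestPaths hX hc hc' hd t
  rw [h0, h1, dist_self, dist_self, mul_zero, mul_zero, add_zero] at this
  exact dist_le_zero.1 this

end Curvature

/-! ### Bigons and simple closed geodesics -/

/-- Shortest paths of length less than `r` are determined by their endpoints. -/
def UniqueShortestPaths (X : Type u) [MetricSpace X] (r : ℝ) : Prop :=
  ∀ c ∈ shortestPaths X, ∀ c' ∈ shortestPaths X, c 0 = c' 0 → c 1 = c' 1 →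
    dist (c 0) (c 1) < r → c = c'

/-- Two distinct shortest paths with the same endpoints. -/
structure IsBigon {X : Type u} [MetricSpace X] (c c' : C(I, X)) : Prop where
  left_mem : c ∈ shortestPaths X
  right_mem : c' ∈ shortestPaths X
  zero_eq : c 0 = c' 0
  one_eq : c 1 = c' 1
  ne : c ≠ c'

section Bigon

variable {X : Type u} [MetricSpace X] {η : ℝ} {c c' : C(I, X)}

theorem IsBigon.reverse (h : IsBigon c c') : IsBigon (subpath c 1 0) (subpath c' 1 0) where
  left_mem := subpath_mem_shortestPaths h.left_mem _ _
  right_mem := subpath_mem_shortestPaths h.right_mem _ _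
  zero_eq := by simpa using h.one_eq
  one_eq := by simpa using h.zero_eq
  ne hne := h.ne <| by
    ext t
    have := DFunLike.congr_fun hne (unitInterval.symm t)
    rwa [subpath_apply c 1 0 _ t (by simp), subpath_apply c' 1 0 _ t (by simp)] at this

theorem IsBigon.dist_pos (h : IsBigon c c') : 0 < dist (c 0) (c 1) := by
  refine lt_of_le_of_ne dist_nonneg fun h0 => h.ne ?_
  ext t
  have e1 := dist_zero_of_mem_shortestPaths h.left_mem t
  have e2 := dist_zero_of_mem_shortestPaths h.right_mem t
  rw [← h.zero_eq, ← h.one_eq] at e2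
  rw [← h0, zero_mul, dist_eq_zero] at e1 e2
  rw [← e1, ← e2]

theorem dist_subpath_le {c : C(I, X)} (hc : c ∈ shortestPaths X) (s : I) :
    dist (subpath c 0 (unitInterval.symm s)) c ≤ s * dist (c 0) (c 1) := by
  refine (ContinuousMap.dist_le (mul_nonneg s.2.1 dist_nonneg)).2 fun t => ?_
  change dist (c _) (c t) ≤ _
  rw [hc, mul_comm]
  refine mul_le_mul_of_nonneg_right ?_ dist_nonneg
  simp only [unitInterval.coe_symm_eq, Set.Icc.coe_zero]
  rw [show (1 - (t : ℝ)) * 0 + t * (1 - s) - t = -(s * t) by ring, abs_neg,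
    abs_of_nonneg (mul_nonneg s.2.1 t.2.1)]
  exact mul_le_of_le_one_right s.2.1 t.2.2

/-- In nonpositive curvature, there is a shortest bigon as soon as there is a bigon: distinct sides
of a bigon keep a definite distance, so bigons cannot degenerate. -/
theorem NonposCurvedAtScale.exists_minimal_bigon [CompactSpace X]
    (hη : NonposCurvedAtScale X η) (hη0 : 0 < η) (hX : IsLengthMetric X) (h : IsBigon c c') :
    ∃ d d' : C(I, X), IsBigon d d' ∧ dist (d 0) (d 1) ≤ dist (c 0) (c 1) ∧
      UniqueShortestPaths X (dist (d 0) (d 1)) := by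
  set B : Set (C(I, X) × C(I, X)) := {x | IsBigon x.1 x.2} with hB
  have hBeq : B = (shortestPaths X ×ˢ shortestPaths X) ∩
      ({x | x.1 0 = x.2 0} ∩ ({x | x.1 1 = x.2 1} ∩ {x | η / 3 ≤ dist x.1 x.2})) := by
    ext ⟨x, y⟩
    constructor
    · intro hb
      refine ⟨⟨hb.left_mem, hb.right_mem⟩, hb.zero_eq, hb.one_eq, ?_⟩
      by_contra hlt
      exact hb.ne (hη.eq_of_dist_lt hX hb.left_mem hb.right_mem (not_le.1 hlt) hb.zero_eq
        hb.one_eq)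
    · rintro ⟨⟨h1, h2⟩, h3, h4, h5⟩
      refine ⟨h1, h2, h3, h4, fun he => ?_⟩
      change x = y at he
      subst he
      rw [Set.mem_ofPred_eq, dist_self] at h5
      linarith
  have hBc : IsCompact B := by
    rw [hBeq]
    refine (isCompact_shortestPaths.prod isCompact_shortestPaths).inter_right ?_
    have q1 : IsClosed {x : C(I, X) × C(I, X) | x.1 0 = x.2 0} :=
      isClosed_eq (by fun_prop) (by fun_prop)
    have q2 : IsClosed {x : C(I, X) × C(I, X) | x.1 1 = x.2 1} :=
      isClosed_eq (by fun_prop) (by fun_prop)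
    have q3 : IsClosed {x : C(I, X) × C(I, X) | η / 3 ≤ dist x.1 x.2} :=
      isClosed_le (by fun_prop) (by fun_prop)
    exact q1.inter (q2.inter q3)
  obtain ⟨⟨d, d'⟩, hd, hmin⟩ := hBc.exists_isMinOn ⟨(c, c'), h⟩
    (f := fun x : C(I, X) × C(I, X) => dist (x.1 0) (x.1 1)) (by fun_prop)
  have hmin' : ∀ x ∈ B, dist (d 0) (d 1) ≤ dist (x.1 0) (x.1 1) := fun x hx => hmin hx
  refine ⟨d, d', hd, hmin' (c, c') h, fun e he e' he' h0 h1 hlt => ?_⟩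
  by_contra hne
  have hb : (e, e') ∈ B := ⟨he, he', h0, h1, hne⟩
  exact absurd (hmin' _ hb) (not_le.2 hlt)

/-- The two sides of a shortest bigon form a geodesic at their common endpoint. Otherwise, points
of the two sides near the endpoint `c 1` could be joined by a path along which the distance to `c 0`
is less than the length of the bigon. The shortest paths from `c 0` to the points of that path vary
continuously from one side of the bigon to the other, and in the limit they yield a shortest path
from `c 0` to `c 1` which is too close to `c` without being equal to it. -/
theorem NonposCurvedAtScale.exists_dist_symm_eq [CompactSpace X]
    (hη : NonposCurvedAtScale X η) (hη0 : 0 < η) (hX : IsLengthMetric X) (h : IsBigon c c')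
    (hU : UniqueShortestPaths X (dist (c 0) (c 1))) :
    ∃ s : I, 0 < (s : ℝ) ∧ s < 1 ∧ dist (c (unitInterval.symm s)) (c' (unitInterval.symm s)) =
      2 * s * dist (c 0) (c 1) := by
  by_contra! hne
  have hc := h.left_mem
  have hc' := h.right_mem
  have hD := h.dist_pos
  have hD' : dist (c' 0) (c' 1) = dist (c 0) (c 1) := by rw [h.zero_eq, h.one_eq]
  set D := dist (c 0) (c 1) with hDdef
  have htr : ∀ s : I, 0 < (s : ℝ) → s < 1 →
      dist (c (unitInterval.symm s)) (c' (unitInterval.symm s)) < 2 * s * D := by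
    intro s h0 h1
    refine lt_of_le_of_ne ?_ (hne s h0 h1)
    have e1 := dist_one_of_mem_shortestPaths hc (unitInterval.symm s)
    have e2 := dist_one_of_mem_shortestPaths hc' (unitInterval.symm s)
    rw [hD', ← h.one_eq] at e2
    simp only [unitInterval.coe_symm_eq] at e1 e2
    have := dist_triangle_right (c (unitInterval.symm s)) (c' (unitInterval.symm s)) (c 1)
    linarith
  have hfar : η / 3 ≤ dist c c' := by
    by_contra hlt
    exact h.ne (hη.eq_of_dist_lt hX hc hc' (not_le.1 hlt) h.zero_eq h.one_eq)
  have hpert : ∀ ε > 0, ∃ τ ∈ shortestPaths X, τ 0 = c 0 ∧ dist τ c = η / 6 ∧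
      dist (τ 1) (c 1) ≤ ε := by
    intro ε hε
    obtain ⟨s, hs0, hs1, hsη, hsε⟩ : ∃ s : I, 0 < (s : ℝ) ∧ s < 1 ∧ s * D ≤ η / 12 ∧
        3 * (s * D) ≤ ε := by
      set x := min (1 / 2) (min (η / 12 / D) (ε / 3 / D)) with hx
      have hx0 : 0 < x := by positivity
      have hx1 : x ≤ 1 / 2 := min_le_left _ _
      refine ⟨⟨x, hx0.le, by linarith⟩, hx0, ?_, ?_, ?_⟩
      · exact Subtype.coe_lt_coe.1 (show x < 1 by linarith)
      · exact (le_div_iff₀ hD).1 ((min_le_right _ _).trans (min_le_left _ _))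
      · have : x * D ≤ ε / 3 := (le_div_iff₀ hD).1 ((min_le_right _ _).trans (min_le_right _ _))
        change 3 * (x * D) ≤ ε
        linarith
    set u := unitInterval.symm s with hu
    obtain ⟨e, he, he0, he1⟩ := exists_shortestPath hX (c u) (c' u)
    have hab := htr s hs0 hs1
    have ea : dist (c 0) (c u) = D * (1 - s) := by
      rw [dist_zero_of_mem_shortestPaths hc, hu, unitInterval.coe_symm_eq]
    have eb : dist (c 0) (c' u) = D * (1 - s) := by
      rw [h.zero_eq, dist_zero_of_mem_shortestPaths hc', hu, unitInterval.coe_symm_eq, hD']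
    have hlt : ∀ t, dist (c 0) (e t) < D := by
      intro t
      have e1 := dist_zero_of_mem_shortestPaths he t
      have e2 := dist_one_of_mem_shortestPaths he t
      rw [he0, he1] at e1 e2
      have t1 := dist_triangle (c 0) (c u) (e t)
      have t2 := dist_triangle_right (c 0) (e t) (c' u)
      nlinarith
    choose τ hτ hτ0 hτ1 using fun t => exists_shortestPath hX (c 0) (e t)
    have hcont : Continuous τ := by
      refine Metric.continuous_iff.2 fun t ε' hε' => ?_
      obtain ⟨δ, hδ, hδ'⟩ := exists_forall_dist_lt_of_unique (c := τ t) (fun c'' h'' h0 h1 =>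
        hU _ h'' _ (hτ t) h0 h1 (by rw [h0, h1, hτ0, hτ1]; exact hlt t)) hε'
      obtain ⟨δ', hδ0', he'⟩ := Metric.continuous_iff.1 e.continuous t δ hδ
      refine ⟨δ', hδ0', fun t' ht' => hδ' _ (hτ t') ?_ ?_⟩
      · rwa [hτ0, hτ0, dist_self]
      · rw [hτ1, hτ1]
        exact he' _ ht'
    have hτ_zero : τ 0 = subpath c 0 u := by
      refine hU _ (hτ 0) _ (subpath_mem_shortestPaths hc _ _) ?_ ?_ ?_
      · rw [hτ0, subpath_zero]
      · rw [hτ1, subpath_one, he0]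
      · rw [hτ0, hτ1]
        exact hlt 0
    have hτ_one : τ 1 = subpath c' 0 u := by
      refine hU _ (hτ 1) _ (subpath_mem_shortestPaths hc' _ _) ?_ ?_ ?_
      · rw [hτ0, subpath_zero, h.zero_eq]
      · rw [hτ1, subpath_one, he1]
      · rw [hτ0, hτ1]
        exact hlt 1
    have d0 : dist (τ 0) c ≤ s * D := by
      rw [hτ_zero]
      exact dist_subpath_le hc s
    have d1 : dist (τ 1) c' ≤ s * D := by
      rw [hτ_one, ← hD']
      exact dist_subpath_le hc' s
    have d2 := dist_triangle_left c c' (τ 1)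
    obtain ⟨t, -, ht⟩ : η / 6 ∈ (fun t => dist (τ t) c) '' Set.Icc (0 : I) 1 :=
      intermediate_value_Icc zero_le_one (by fun_prop) ⟨by linarith, by linarith⟩
    refine ⟨τ t, hτ t, hτ0 t, ht, ?_⟩
    have e1 := dist_zero_of_mem_shortestPaths he t
    have e3 := dist_one_of_mem_shortestPaths hc u
    rw [he0, he1] at e1
    rw [hu, unitInterval.coe_symm_eq, ← hu] at e3
    have t1 := dist_triangle_left (e t) (c 1) (c u)
    have t2 : dist (c u) (c' u) * t ≤ dist (c u) (c' u) :=
      mul_le_of_le_one_right dist_nonneg t.2.2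
    rw [hτ1]
    linarith
  have q1 : IsClosed {τ : C(I, X) | τ 0 = c 0} := isClosed_eq (by fun_prop) (by fun_prop)
  have q2 : IsClosed {τ : C(I, X) | dist τ c = η / 6} := isClosed_eq (by fun_prop) (by fun_prop)
  obtain ⟨τ₁, h₁, h₁', h₁'', -⟩ := hpert 1 one_pos
  obtain ⟨τ, ⟨hτ, hτ0, hτd⟩, hmin⟩ :=
    (isCompact_shortestPaths.inter_right (q1.inter q2)).exists_isMinOn ⟨τ₁, h₁, h₁', h₁''⟩
      (f := fun τ : C(I, X) => dist (τ 1) (c 1)) (Continuous.continuousOn (by fun_prop))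
  have hτ1 : τ 1 = c 1 := by
    refine dist_le_zero.1 (le_of_forall_pos_le_add fun ε hε => ?_)
    obtain ⟨τ', h1, h2, h3, h4⟩ := hpert ε hε
    have : dist (τ 1) (c 1) ≤ dist (τ' 1) (c 1) := hmin ⟨h1, h2, h3⟩
    linarith
  rw [Set.mem_ofPred_eq] at hτ0 hτd
  have := hη.eq_of_dist_lt hX hτ hc (by linarith) hτ0 hτ1
  rw [this, dist_self] at hτd
  linarith

/-- The concatenation of the sides of a shortest bigon is a shortest path near `c 1`, by the triangle
inequality from the case of two points at the same distance of `c 1`. -/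
theorem NonposCurvedAtScale.exists_corner_one [CompactSpace X]
    (hη : NonposCurvedAtScale X η) (hη0 : 0 < η) (hX : IsLengthMetric X) (h : IsBigon c c')
    (hU : UniqueShortestPaths X (dist (c 0) (c 1))) :
    ∃ s : ℝ, 0 < s ∧ s < 1 ∧ ∀ u v : I, 1 - s ≤ u → 1 - s ≤ v →
      dist (c u) (c' v) = dist (c 0) (c 1) * ((1 - u) + (1 - v)) := by
  obtain ⟨s, hs0, hs1, hs⟩ := hη.exists_dist_symm_eq hη0 hX h hU
  refine ⟨s, hs0, Subtype.coe_lt_coe.2 hs1, fun u v hu hv => le_antisymm ?_ ?_⟩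
  · have e1 := dist_one_of_mem_shortestPaths h.left_mem u
    have e2 := dist_one_of_mem_shortestPaths h.right_mem v
    rw [← h.one_eq, ← h.zero_eq] at e2
    have := dist_triangle_right (c u) (c' v) (c 1)
    linarith
  · have e1 := h.left_mem (unitInterval.symm s) u
    have e2 := h.right_mem v (unitInterval.symm s)
    rw [← h.one_eq, ← h.zero_eq] at e2
    rw [unitInterval.coe_symm_eq, abs_sub_comm, abs_of_nonneg (by linarith)] at e1
    rw [unitInterval.coe_symm_eq, abs_of_nonneg (by linarith)] at e2
    have := dist_triangle4 (c (unitInterval.symm s)) (c u) (c' v) (c' (unitInterval.symm s))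
    linarith

theorem NonposCurvedAtScale.exists_corner_zero [CompactSpace X]
    (hη : NonposCurvedAtScale X η) (hη0 : 0 < η) (hX : IsLengthMetric X) (h : IsBigon c c')
    (hU : UniqueShortestPaths X (dist (c 0) (c 1))) :
    ∃ s : ℝ, 0 < s ∧ s < 1 ∧ ∀ u v : I, (u : ℝ) ≤ s → (v : ℝ) ≤ s →
      dist (c u) (c' v) = dist (c 0) (c 1) * (u + v) := by
  obtain ⟨s, hs0, hs1, hs⟩ := hη.exists_corner_one hη0 hX h.reverse
    (by rwa [subpath_zero, subpath_one, dist_comm])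
  refine ⟨s, hs0, hs1, fun u v hu hv => ?_⟩
  have := hs (unitInterval.symm u) (unitInterval.symm v) (by simp; linarith) (by simp; linarith)
  rw [subpath_apply c 1 0 _ u (by simp), subpath_apply c' 1 0 _ v (by simp), subpath_zero,
    subpath_one, dist_comm (c 1)] at this
  simpa using this

/-- The sides of a shortest bigon meet only at their endpoints. -/
theorem IsBigon.eq_and_eq_of_apply_eq (h : IsBigon c c')
    (hU : UniqueShortestPaths X (dist (c 0) (c 1))) {u v : I} (huv : c u = c' v) :
    u = v ∧ (u = 0 ∨ u = 1) := by
  have hD := h.dist_pos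
  have e1 := dist_zero_of_mem_shortestPaths h.left_mem u
  have e2 := dist_zero_of_mem_shortestPaths h.right_mem v
  rw [← h.one_eq, ← h.zero_eq] at e2
  rw [huv, e2] at e1
  have heq : u = v := Subtype.ext (mul_left_cancel₀ hD.ne' e1).symm
  subst heq
  refine ⟨rfl, ?_⟩
  by_contra! hne
  have hu0 : 0 < (u : ℝ) := lt_of_le_of_ne u.2.1 fun h => hne.1 (Subtype.ext h.symm)
  have hu1 : (u : ℝ) < 1 := lt_of_le_of_ne u.2.2 fun h => hne.2 (Subtype.ext h)
  -- both halves of the bigon are shorter, hence degenerate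
  have k1 : subpath c 0 u = subpath c' 0 u := by
    refine hU _ (subpath_mem_shortestPaths h.left_mem _ _) _
      (subpath_mem_shortestPaths h.right_mem _ _) (by simpa using h.zero_eq) (by simpa using huv) ?_
    rw [subpath_zero, subpath_one, dist_zero_of_mem_shortestPaths h.left_mem]
    exact mul_lt_of_lt_one_right hD hu1
  have k2 : subpath c u 1 = subpath c' u 1 := by
    refine hU _ (subpath_mem_shortestPaths h.left_mem _ _) _
      (subpath_mem_shortestPaths h.right_mem _ _) (by simpa using huv) (by simpa using h.one_eq) ?_
    rw [subpath_zero, subpath_one, dist_one_of_mem_shortestPaths h.left_mem]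
    exact mul_lt_of_lt_one_right hD (by linarith)
  refine h.ne ?_
  ext t
  rcases le_total (t : ℝ) u with ht | ht
  · have := DFunLike.congr_fun k1 ⟨t / u, div_nonneg t.2.1 hu0.le, (div_le_one hu0).2 ht⟩
    have hw : (t : ℝ) = (1 - t / u) * (0 : I) + t / u * u := by
      simp; field_simp
    rwa [subpath_apply c 0 u _ t hw, subpath_apply c' 0 u _ t hw] at this
  · have h1u : 0 < 1 - (u : ℝ) := by linarith
    have := DFunLike.congr_fun k2 ⟨(t - u) / (1 - u), div_nonneg (by linarith) h1u.le,
      (div_le_one h1u).2 (by linarith [t.2.2])⟩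
    have hw : (t : ℝ) = (1 - (t - u) / (1 - u)) * u + (t - u) / (1 - u) * (1 : I) := by
      simp; field_simp; ring
    rwa [subpath_apply c u 1 _ t hw, subpath_apply c' u 1 _ t hw] at this

end Bigon

section ClosedGeodesic

variable {X : Type u} [MetricSpace X] {η : ℝ} {c c' : C(I, X)}

/-- The curve on `[-dist (c 0) (c 1), dist (c 0) (c 1)]` with unit speed that runs along the second
side `c'` of the bigon back to `c 0` and then along the first side `c`. It is constant on either side
of this interval. -/
noncomputable def bigonCurve (c c' : C(I, X)) (t : ℝ) : X :=
  if 0 ≤ t then c (Set.projIcc 0 1 zero_le_one (t / dist (c 0) (c 1)))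
  else c' (Set.projIcc 0 1 zero_le_one (-t / dist (c 0) (c 1)))

/-- The closed curve that runs along both sides of a bigon, as a periodic map. -/
noncomputable def bigonLoop (c c' : C(I, X)) (hD : 0 < 2 * dist (c 0) (c 1)) (t : ℝ) : X :=
  bigonCurve c c' (toIcoMod hD (-dist (c 0) (c 1)) t)

theorem IsBigon.bigonCurve_of_nonneg (h : IsBigon c c') {t : ℝ} (h0 : 0 ≤ t)
    (h1 : t ≤ dist (c 0) (c 1)) :
    ∃ u : I, (u : ℝ) * dist (c 0) (c 1) = t ∧ bigonCurve c c' t = c u := by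
  have hD := h.dist_pos
  refine ⟨⟨t / dist (c 0) (c 1), by positivity, (div_le_one hD).2 h1⟩, ?_, ?_⟩
  · exact div_mul_cancel₀ _ hD.ne'
  · rw [bigonCurve, if_pos h0, Set.projIcc_of_mem _ ⟨by positivity, (div_le_one hD).2 h1⟩]

theorem IsBigon.bigonCurve_of_nonpos (h : IsBigon c c') {t : ℝ} (h0 : t ≤ 0)
    (h1 : -dist (c 0) (c 1) ≤ t) :
    ∃ u : I, (u : ℝ) * dist (c 0) (c 1) = -t ∧ bigonCurve c c' t = c' u := by
  have hD := h.dist_pos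
  refine ⟨⟨-t / dist (c 0) (c 1), div_nonneg (by linarith) hD.le,
    (div_le_one hD).2 (by linarith)⟩, ?_, ?_⟩
  · exact div_mul_cancel₀ _ hD.ne'
  · rcases h0.eq_or_lt with rfl | h0
    · have e : (⟨-0 / dist (c 0) (c 1), div_nonneg (by linarith) hD.le,
        (div_le_one hD).2 (by linarith)⟩ : I) = 0 := Subtype.ext (by simp)
      rw [bigonCurve, if_pos le_rfl, e, ← h.zero_eq, zero_div]
      simp
    · rw [bigonCurve, if_neg h0.not_ge, Set.projIcc_of_mem _ ⟨div_nonneg (by linarith) hD.le,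
        (div_le_one hD).2 (by linarith)⟩]

theorem IsBigon.dist_bigonCurve_of_nonneg (h : IsBigon c c') {a b : ℝ}
    (ha : a ∈ Set.Icc 0 (dist (c 0) (c 1))) (hb : b ∈ Set.Icc 0 (dist (c 0) (c 1))) :
    dist (bigonCurve c c' a) (bigonCurve c c' b) = dist a b := by
  obtain ⟨u, hu, hcu⟩ := h.bigonCurve_of_nonneg ha.1 ha.2
  obtain ⟨v, hv, hcv⟩ := h.bigonCurve_of_nonneg hb.1 hb.2
  rw [hcu, hcv, h.left_mem, Real.dist_eq, ← hu, ← hv, ← sub_mul, abs_mul,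
    abs_of_nonneg (dist_nonneg (x := c 0)), mul_comm]

theorem IsBigon.dist_bigonCurve_of_nonpos (h : IsBigon c c') {a b : ℝ}
    (ha : a ∈ Set.Icc (-dist (c 0) (c 1)) 0) (hb : b ∈ Set.Icc (-dist (c 0) (c 1)) 0) :
    dist (bigonCurve c c' a) (bigonCurve c c' b) = dist a b := by
  obtain ⟨u, hu, hcu⟩ := h.bigonCurve_of_nonpos ha.2 ha.1
  obtain ⟨v, hv, hcv⟩ := h.bigonCurve_of_nonpos hb.2 hb.1
  rw [hcu, hcv, h.right_mem, ← h.zero_eq, ← h.one_eq, Real.dist_eq, show a - b = -b - -a by ring,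
    ← hu, ← hv, ← sub_mul, abs_mul, abs_of_nonneg (dist_nonneg (x := c 0)), mul_comm,
    abs_sub_comm]

theorem IsBigon.injOn_bigonCurve (h : IsBigon c c')
    (hU : UniqueShortestPaths X (dist (c 0) (c 1))) :
    Set.InjOn (bigonCurve c c') (Set.Ico (-dist (c 0) (c 1)) (dist (c 0) (c 1))) := by
  have hD := h.dist_pos
  have mixed : ∀ a b : ℝ, 0 ≤ a → a < dist (c 0) (c 1) → b ≤ 0 → -dist (c 0) (c 1) ≤ b →
      bigonCurve c c' a = bigonCurve c c' b → a = b := by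
    intro a b ha ha' hb hb' hab
    obtain ⟨u, hu, hcu⟩ := h.bigonCurve_of_nonneg ha ha'.le
    obtain ⟨v, hv, hcv⟩ := h.bigonCurve_of_nonpos hb hb'
    rw [hcu, hcv] at hab
    obtain ⟨rfl, rfl | rfl⟩ := h.eq_and_eq_of_apply_eq hU hab
    · simp at hu hv
      linarith
    · simp at hu
      linarith
  intro a ha b hb hab
  rcases le_total 0 a with h0a | h0a <;> rcases le_total 0 b with h0b | h0b
  · rw [← dist_eq_zero, ← h.dist_bigonCurve_of_nonneg ⟨h0a, ha.2.le⟩ ⟨h0b, hb.2.le⟩, hab, dist_self]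
  · exact mixed a b h0a ha.2 h0b hb.1 hab
  · exact (mixed b a h0b hb.2 h0a ha.1 hab.symm).symm
  · rw [← dist_eq_zero, ← h.dist_bigonCurve_of_nonpos ⟨ha.1, h0a⟩ ⟨hb.1, h0b⟩, hab, dist_self]

theorem periodic_bigonLoop (hD : 0 < 2 * dist (c 0) (c 1)) :
    Function.Periodic (bigonLoop c c' hD) (2 * dist (c 0) (c 1)) := fun t => by
  rw [bigonLoop, toIcoMod_add_right, bigonLoop]

theorem bigonLoop_of_mem (hD : 0 < 2 * dist (c 0) (c 1)) {t : ℝ}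
    (ht : t ∈ Set.Ico (-dist (c 0) (c 1)) (dist (c 0) (c 1))) :
    bigonLoop c c' hD t = bigonCurve c c' t := by
  rw [bigonLoop, (toIcoMod_eq_self hD).2 ⟨ht.1, by linarith [ht.2]⟩]

/-- A shortest bigon is a simple closed curve. -/
theorem IsBigon.injOn_bigonLoop (h : IsBigon c c')
    (hU : UniqueShortestPaths X (dist (c 0) (c 1))) (hD : 0 < 2 * dist (c 0) (c 1)) :
    Set.InjOn (bigonLoop c c' hD) (Set.Ico 0 (2 * dist (c 0) (c 1))) := by
  have hmod : ∀ t, toIcoMod hD (-dist (c 0) (c 1)) t ∈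
      Set.Ico (-dist (c 0) (c 1)) (dist (c 0) (c 1)) := fun t => by
    have := toIcoMod_mem_Ico hD (-dist (c 0) (c 1)) t
    exact ⟨this.1, by linarith [this.2]⟩
  intro a ha b hb hab
  have e := h.injOn_bigonCurve hU (hmod a) (hmod b) hab
  obtain ⟨n, hn⟩ := (toIcoMod_eq_toIcoMod hD).1 e
  rw [zsmul_eq_mul] at hn
  have n1 : (n : ℝ) < 1 := by
    by_contra! hle
    nlinarith [ha.1, hb.2]
  have n2 : (-1 : ℝ) < n := by
    by_contra! hle
    nlinarith [ha.2, hb.1]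
  have n3 : n = 0 := by
    have : n < 1 := by exact_mod_cast n1
    have : -1 < n := by exact_mod_cast n2
    omega
  rw [n3, Int.cast_zero, zero_mul] at hn
  linarith

/-- In nonpositive curvature, a shortest bigon is a closed geodesic, also at its two corners. -/
theorem NonposCurvedAtScale.locally_isometric_bigonLoop [CompactSpace X]
    (hη : NonposCurvedAtScale X η) (hη0 : 0 < η) (hX : IsLengthMetric X) (h : IsBigon c c')
    (hU : UniqueShortestPaths X (dist (c 0) (c 1))) (hD : 0 < 2 * dist (c 0) (c 1)) (t : ℝ) :
    ∃ U ∈ 𝓝 t, ∀ a ∈ U, ∀ b ∈ U,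
      dist (bigonLoop c c' hD a) (bigonLoop c c' hD b) = dist a b := by
  have hD0 := h.dist_pos
  have hper := periodic_bigonLoop (c' := c') hD
  set D := dist (c 0) (c 1) with hDdef
  -- it suffices to treat the parameters of one period
  wlog ht : t ∈ Set.Ico (-D) D generalizing t
  · set t' := toIcoMod hD (-D) t with ht'
    have hmem := toIcoMod_mem_Ico hD (-D) t
    obtain ⟨U, hU, hd⟩ := this t' ⟨hmem.1, by linarith [hmem.2]⟩
    set n := toIcoDiv hD (-D) t
    have hn : t - n * (2 * D) = t' := by
      rw [ht', toIcoMod, zsmul_eq_mul]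
    refine ⟨(fun s => s - n * (2 * D)) ⁻¹' U, ?_, fun a ha b hb => ?_⟩
    · refine ContinuousAt.preimage_mem_nhds (by fun_prop) ?_
      rwa [hn]
    · have := hd _ ha _ hb
      rwa [hper.sub_int_mul_eq, hper.sub_int_mul_eq, dist_sub_right] at this
  rcases ht.1.eq_or_lt with hte | hlt
  · subst hte
    obtain ⟨s, hs0, hs1, hs⟩ := hη.exists_corner_one hη0 hX h hU
    -- the corner `c 1`; parameters `a < -D` are moved by a period
    have hmin : 0 < min D (s * D) := by positivity
    have hleft : ∀ a, -D - min D (s * D) < a → a < -D →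
        bigonLoop c c' hD a = bigonCurve c c' (a + 2 * D) := by
      intro a ha ha'
      rw [← hper a, bigonLoop_of_mem]
      constructor <;> linarith [min_le_left D (s * D)]
    have hmixed : ∀ a b, -D - min D (s * D) < a → a < -D → -D ≤ b → b < -D + min D (s * D) →
        dist (bigonLoop c c' hD a) (bigonLoop c c' hD b) = dist a b := by
      intro a b ha ha' hb hb'
      have m1 := min_le_left D (s * D)
      have m2 := min_le_right D (s * D)
      rw [hleft a ha ha', bigonLoop_of_mem hD ⟨hb, by linarith⟩]
      obtain ⟨u, hu, hcu⟩ := h.bigonCurve_of_nonneg (t := a + 2 * D) (by linarith) (by linarith)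
      obtain ⟨v, hv, hcv⟩ := h.bigonCurve_of_nonpos (t := b) (by linarith) hb
      rw [← hDdef] at hu hv
      rw [hcu, hcv, hs u v, dist_comm a, Real.dist_eq, abs_of_nonneg (by linarith), ← hDdef]
      · linarith
      · by_contra! hlt
        nlinarith
      · by_contra! hlt
        nlinarith
    refine ⟨Set.Ioo (-D - min D (s * D)) (-D + min D (s * D)),
      Ioo_mem_nhds (by linarith) (by linarith), fun a ha b hb => ?_⟩
    have m1 := min_le_left D (s * D)
    rcases lt_or_ge a (-D) with ha' | ha' <;> rcases lt_or_ge b (-D) with hb' | hb'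
    · rw [hleft a ha.1 ha', hleft b hb.1 hb', h.dist_bigonCurve_of_nonneg, dist_add_right]
      · constructor <;> linarith [ha.1]
      · constructor <;> linarith [hb.1]
    · exact hmixed a b ha.1 ha' hb' hb.2
    · rw [dist_comm, dist_comm a]
      exact hmixed b a hb.1 hb' ha' ha.2
    · rw [bigonLoop_of_mem hD ⟨ha', by linarith [ha.2]⟩,
        bigonLoop_of_mem hD ⟨hb', by linarith [hb.2]⟩, h.dist_bigonCurve_of_nonpos]
      · exact ⟨ha', by linarith [ha.2]⟩
      · exact ⟨hb', by linarith [hb.2]⟩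
  · rcases lt_trichotomy t 0 with h0 | rfl | h0
    · refine ⟨Set.Ioo (-D) 0, Ioo_mem_nhds hlt h0, fun a ha b hb => ?_⟩
      rw [bigonLoop_of_mem hD ⟨ha.1.le, by linarith [ha.2]⟩,
        bigonLoop_of_mem hD ⟨hb.1.le, by linarith [hb.2]⟩, h.dist_bigonCurve_of_nonpos]
      · exact ⟨ha.1.le, ha.2.le⟩
      · exact ⟨hb.1.le, hb.2.le⟩
    · obtain ⟨s, hs0, hs1, hs⟩ := hη.exists_corner_zero hη0 hX h hU
      have hsD : 0 < s * D := by positivity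
      have hsD' : s * D < D := by nlinarith
      have hmixed : ∀ a b, 0 ≤ a → a < s * D → b ≤ 0 → -(s * D) < b →
          dist (bigonCurve c c' a) (bigonCurve c c' b) = dist a b := by
        intro a b ha ha' hb hb'
        obtain ⟨u, hu, hcu⟩ := h.bigonCurve_of_nonneg (t := a) (by linarith) (by linarith)
        obtain ⟨v, hv, hcv⟩ := h.bigonCurve_of_nonpos (t := b) (by linarith) (by linarith)
        rw [← hDdef] at hu hv
        rw [hcu, hcv, hs u v, Real.dist_eq, abs_of_nonneg (by linarith)]
        · linarith
        · by_contra! hlt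
          nlinarith
        · by_contra! hlt
          nlinarith
      refine ⟨Set.Ioo (-(s * D)) (s * D), Ioo_mem_nhds (by linarith) (by linarith),
        fun a ha b hb => ?_⟩
      rw [bigonLoop_of_mem hD ⟨by linarith [ha.1], by linarith [ha.2]⟩,
        bigonLoop_of_mem hD ⟨by linarith [hb.1], by linarith [hb.2]⟩]
      rcases le_total 0 a with ha' | ha' <;> rcases le_total 0 b with hb' | hb'
      · exact h.dist_bigonCurve_of_nonneg ⟨ha', by linarith [ha.2]⟩ ⟨hb', by linarith [hb.2]⟩
      · exact hmixed a b ha' ha.2 hb' hb.1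
      · rw [dist_comm, dist_comm a]
        exact hmixed b a hb' hb.2 ha' ha.1
      · exact h.dist_bigonCurve_of_nonpos ⟨by linarith [ha.1], ha'⟩ ⟨by linarith [hb.1], hb'⟩
    · refine ⟨Set.Ioo 0 D, Ioo_mem_nhds h0 ht.2, fun a ha b hb => ?_⟩
      rw [bigonLoop_of_mem hD ⟨by linarith [ha.1], ha.2⟩,
        bigonLoop_of_mem hD ⟨by linarith [hb.1], hb.2⟩, h.dist_bigonCurve_of_nonneg]
      · exact ⟨ha.1.le, ha.2.le⟩
      · exact ⟨hb.1.le, hb.2.le⟩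

/-- The closed curve that runs along a bigon is not longer than the two sides together. -/
theorem IsBigon.curveLength_bigonLoop_le (h : IsBigon c c') (hD : 0 < 2 * dist (c 0) (c 1)) :
    curveLength (bigonLoop c c' hD) 0 (2 * dist (c 0) (c 1)) ≤
      ENNReal.ofReal (2 * dist (c 0) (c 1)) := by
  have hD0 := h.dist_pos
  have hper := periodic_bigonLoop (c' := c') hD
  have hend : bigonCurve c c' (dist (c 0) (c 1)) = bigonCurve c c' (-dist (c 0) (c 1)) := by
    obtain ⟨u, hu, hcu⟩ := h.bigonCurve_of_nonneg hD0.le le_rfl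
    obtain ⟨v, hv, hcv⟩ := h.bigonCurve_of_nonpos (t := -dist (c 0) (c 1)) (by linarith) le_rfl
    have hu1 : u = 1 := Subtype.ext (mul_right_cancel₀ hD0.ne' (by rw [hu]; simp))
    have hv1 : v = 1 := Subtype.ext (mul_right_cancel₀ hD0.ne' (by rw [hv]; simp))
    rw [hcu, hcv, hu1, hv1, h.one_eq]
  have hright : ∀ t ∈ Set.Icc (dist (c 0) (c 1)) (2 * dist (c 0) (c 1)),
      bigonLoop c c' hD t = bigonCurve c c' (t - 2 * dist (c 0) (c 1)) := fun t ht => by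
    rw [← hper.sub_eq, bigonLoop_of_mem]
    constructor <;> linarith [ht.1, ht.2]
  have hleft : ∀ t ∈ Set.Icc 0 (dist (c 0) (c 1)),
      bigonLoop c c' hD t = bigonCurve c c' t := fun t ht => by
    rcases ht.2.eq_or_lt with rfl | hlt
    · rw [hright _ ⟨le_rfl, by linarith⟩, hend]
      congr 1
      ring
    · exact bigonLoop_of_mem hD ⟨by linarith [ht.1], hlt⟩
  have hlen : ∀ {a b : ℝ}, a ≤ b → (∀ x ∈ Set.Icc a b, ∀ y ∈ Set.Icc a b,
      dist (bigonLoop c c' hD x) (bigonLoop c c' hD y) = dist x y) →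
      eVariationOn (bigonLoop c c' hD) (Set.Icc a b) ≤ ENNReal.ofReal (b - a) := by
    intro a b hab hd
    have hl : LipschitzOnWith 1 (bigonLoop c c' hD) (Set.Icc a b) :=
      LipschitzOnWith.of_dist_le_mul fun x hx y hy => by simpa using (hd x hx y hy).le
    have h1 := hl.comp_eVariationOn_le (f := bigonLoop c c' hD) (Set.mapsTo_id (Set.Icc a b))
    have h2 := (monotone_id.monotoneOn (Set.Icc a b)).eVariationOn_eq
      ⟨le_rfl, hab⟩ ⟨hab, le_rfl⟩
    rw [Set.inter_self] at h2
    rw [Function.comp_id, ENNReal.coe_one, one_mul] at h1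
    exact h1.trans h2.le
  have hadd := eVariationOn.Icc_add_Icc (bigonLoop c c' hD) (s := Set.univ) hD0.le
    (by linarith : dist (c 0) (c 1) ≤ 2 * dist (c 0) (c 1)) trivial
  simp only [Set.univ_inter] at hadd
  rw [curveLength, ← hadd]
  refine (add_le_add (hlen hD0.le fun x hx y hy => ?_)
    (hlen (by linarith) fun x hx y hy => ?_)).trans ?_
  · rw [hleft x hx, hleft y hy, h.dist_bigonCurve_of_nonneg hx hy]
  · rw [hright x hx, hright y hy, h.dist_bigonCurve_of_nonpos, dist_sub_right]
    · constructor <;> linarith [hx.1, hx.2]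
    · constructor <;> linarith [hy.1, hy.2]
  · rw [← ENNReal.ofReal_add (by linarith) (by linarith)]
    exact ENNReal.ofReal_le_ofReal (by linarith)

end ClosedGeodesic

/-- Shortest paths of less than half the length of the systole are determined by their endpoints,
because a shortest bigon is a simple closed geodesic. -/
theorem TranslationSurface.uniqueShortestPaths_of_le_sys (S : TranslationSurface.{u}) {η r : ℝ}
    (hη : NonposCurvedAtScale S.carrier η) (hη0 : 0 < η)
    (hr : ENNReal.ofReal (2 * r) ≤ S.sys) : UniqueShortestPaths S.carrier r := by
  intro c hc c' hc' h0 h1 hlt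
  by_contra hne
  obtain ⟨d, d', hd, hle, hU⟩ :=
    hη.exists_minimal_bigon hη0 S.isLengthMetric ⟨hc, hc', h0, h1, hne⟩
  have hpos := hd.dist_pos
  have hD : 0 < 2 * dist (d 0) (d 1) := by linarith
  have hγ : S.IsSimpleClosedGeodesic (bigonLoop d d' hD) (2 * dist (d 0) (d 1)) :=
    { period_pos := hD
      periodic := periodic_bigonLoop hD
      locally_isometric := hη.locally_isometric_bigonLoop hη0 S.isLengthMetric hd hU hD
      simple := hd.injOn_bigonLoop hU hD }
  have hsys : S.sys ≤ curveLength (bigonLoop d d' hD) 0 (2 * dist (d 0) (d 1)) := by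
    rw [TranslationSurface.sys]
    exact (iInf_le _ (bigonLoop d d' hD)).trans ((iInf_le _ _).trans (iInf_le _ hγ))
  have := (ENNReal.ofReal_le_ofReal_iff hD.le).1 
    (hr.trans (hsys.trans (hd.curveLength_bigonLoop_le hD)))
  linarith

/-! ### Extension of shortest paths -/

/-- Short geodesic segments that end in a point `q` can be continued beyond `q`. -/
def HasLocalExtensions (X : Type u) [MetricSpace X] : Prop :=
  ∀ q : X, ∃ ε > 0, ∀ w, 0 < dist w q → dist w q < ε → ∀ δ, 0 < δ → δ < ε →
    ∃ q', dist q q' = δ ∧ dist w q' = dist w q + δ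

section Extension

variable {X : Type u} [MetricSpace X] {η : ℝ}

/-- The concatenation of two shortest paths is a local geodesic if it is one near the point where
the paths are joined. -/
theorem exists_isLocalGeodesic_concat {c e : C(I, X)} (hc : c ∈ shortestPaths X)
    (he : e ∈ shortestPaths X) (hce : c 1 = e 0) (hD : 0 < dist (c 0) (c 1))
    (hE : 0 < dist (e 0) (e 1)) {s : ℝ} (hs : 0 < s)
    (hcorner : ∀ u v : I, dist (c u) (c 1) ≤ s →
      dist (c u) (e v) = dist (c u) (c 1) + dist (e 0) (e v)) :
    ∃ f : ℝ → X, Continuous f ∧ IsLocalGeodesic f (dist (c 0) (c 1) + dist (e 0) (e 1)) ∧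
      (∀ u : I, f (u * dist (c 0) (c 1) / (dist (c 0) (c 1) + dist (e 0) (e 1))) = c u) ∧
      ∀ v : I, f ((dist (c 0) (c 1) + v * dist (e 0) (e 1)) /
        (dist (c 0) (c 1) + dist (e 0) (e 1))) = e v := by
  have hDc := dist_one_of_mem_shortestPaths hc
  have hEe := dist_zero_of_mem_shortestPaths he
  have hDc' := hc
  have hEe' := he
  simp only [shortestPaths, Set.mem_ofPred_eq] at hDc' hEe'
  set D := dist (c 0) (c 1)
  set E := dist (e 0) (e 1)
  set T := D + E with hT
  have hT0 : 0 < T := by positivity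
  set f : ℝ → X := fun t => if t * T ≤ D then Set.IccExtend zero_le_one c (t * T / D)
    else Set.IccExtend zero_le_one e ((t * T - D) / E) with hf
  have hfc : ∀ u : I, f (u * D / T) = c u := by
    intro u
    have h1 : (u : ℝ) * D / T * T = u * D := div_mul_cancel₀ _ hT0.ne'
    simp only [hf, h1]
    rw [if_pos (mul_le_of_le_one_left hD.le u.2.2), mul_div_cancel_right₀ _ hD.ne',
      Set.IccExtend_of_mem _ _ u.2]
  have hfe : ∀ v : I, f ((D + v * E) / T) = e v := by
    intro v
    have h1 : (D + (v : ℝ) * E) / T * T = D + v * E := div_mul_cancel₀ _ hT0.ne'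
    simp only [hf, h1]
    rw [add_sub_cancel_left, mul_div_cancel_right₀ _ hE.ne', Set.IccExtend_of_mem _ _ v.2]
    split_ifs with h
    · have hv : v = 0 := by
        refine Subtype.ext (le_antisymm ?_ v.2.1)
        change (v : ℝ) ≤ 0
        by_contra! hlt
        nlinarith
      rw [hv, Set.Icc.coe_zero, zero_mul, add_zero, div_self hD.ne', ← hce]
      simp
    · rfl
  have hleft : ∀ t, 0 ≤ t → t * T ≤ D → ∃ u : I, u * D = t * T ∧ f t = c u := by
    intro t h0 h1
    refine ⟨⟨t * T / D, by positivity, (div_le_one hD).2 h1⟩, div_mul_cancel₀ _ hD.ne', ?_⟩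
    rw [← hfc]
    congr 1
    field_simp
  have hright : ∀ t, t ≤ 1 → D ≤ t * T → ∃ v : I, D + v * E = t * T ∧ f t = e v := by
    intro t h1 h0
    have hv1 : (t * T - D) / E ≤ 1 := (div_le_one hE).2 (by nlinarith)
    refine ⟨⟨(t * T - D) / E, div_nonneg (by linarith) hE.le, hv1⟩, ?_, ?_⟩
    · change D + (t * T - D) / E * E = _
      rw [div_mul_cancel₀ _ hE.ne']
      ring
    · rw [← hfe]
      congr 1
      field_simp
      ring
  have hmixed : ∀ a b, 0 ≤ a → D - s ≤ a * T → a * T ≤ D → b ≤ 1 → D ≤ b * T →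
      dist (f a) (f b) = T * |a - b| := by
    intro a b ha has haD hb hbD
    obtain ⟨u, hu, hfu⟩ := hleft a ha haD
    obtain ⟨v, hv, hfv⟩ := hright b hb hbD
    have hab : a ≤ b := le_of_mul_le_mul_right (haD.trans hbD) hT0
    rw [hfu, hfv, hcorner, hDc, hEe, abs_sub_comm, abs_of_nonneg (sub_nonneg.2 hab)]
    · linarith
    · rw [hDc]
      linarith
  have hll : ∀ a b, 0 ≤ a → a * T ≤ D → 0 ≤ b → b * T ≤ D → dist (f a) (f b) = T * |a - b| := by
    intro a b ha ha' hb hb'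
    obtain ⟨u, hu, hfu⟩ := hleft a ha ha'
    obtain ⟨v, hv, hfv⟩ := hleft b hb hb'
    rw [hfu, hfv, hDc', ← abs_of_pos hD, ← abs_mul, ← abs_of_pos hT0, ← abs_mul]
    congr 1
    linarith
  have hrr : ∀ a b, a ≤ 1 → D ≤ a * T → b ≤ 1 → D ≤ b * T → dist (f a) (f b) = T * |a - b| := by
    intro a b ha ha' hb hb'
    obtain ⟨u, hu, hfu⟩ := hright a ha ha'
    obtain ⟨v, hv, hfv⟩ := hright b hb hb'
    rw [hfu, hfv, hEe', ← abs_of_pos hE, ← abs_mul, ← abs_of_pos hT0, ← abs_mul]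
    congr 1
    linarith
  refine ⟨f, ?_, ?_, hfc, hfe⟩
  · refine Continuous.if_le (c.continuous.Icc_extend'.comp (by fun_prop))
      (e.continuous.Icc_extend'.comp (by fun_prop)) (by fun_prop) (by fun_prop) fun t ht => ?_
    rw [ht, div_self hD.ne', sub_self, zero_div]
    simpa using hce
  · intro t ht
    rcases lt_or_ge (t * T) D with hlt | hge
    · have hpos : 0 < min t ((D - t * T) / T) :=
        lt_min ht.1 (div_pos (sub_pos.2 hlt) hT0)
      have hm1 := min_le_left t ((D - t * T) / T)
      have hm2 := (le_div_iff₀ hT0).1 (min_le_right t ((D - t * T) / T))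
      have hside : ∀ a, |a - t| ≤ min t ((D - t * T) / T) → 0 ≤ a ∧ a * T ≤ D := by
        intro a ha
        rw [abs_le] at ha
        constructor <;> nlinarith
      refine ⟨_, hpos, fun a b ha hb => ?_⟩
      exact hll a b (hside a ha).1 (hside a ha).2 (hside b hb).1 (hside b hb).2
    · have ht1 : 0 < 1 - t := sub_pos.2 ht.2
      set ρ := min (min t (1 - t)) (s / T) with hρ
      have hpos : 0 < ρ := lt_min (lt_min ht.1 ht1) (div_pos hs hT0)
      have hm1 : ρ ≤ t := (min_le_left _ _).trans (min_le_left _ _)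
      have hm2 : ρ ≤ 1 - t := (min_le_left _ _).trans (min_le_right _ _)
      have hm3 : ρ * T ≤ s := (le_div_iff₀ hT0).1 (min_le_right _ _)
      have hside : ∀ a, |a - t| ≤ ρ → 0 ≤ a ∧ a ≤ 1 ∧ D - s ≤ a * T := by
        intro a ha
        rw [abs_le] at ha
        refine ⟨by linarith, by linarith, by nlinarith⟩
      refine ⟨ρ, hpos, fun a b ha hb => ?_⟩
      obtain ⟨a0, a1, a2⟩ := hside a ha
      obtain ⟨b0, b1, b2⟩ := hside b hb
      rcases le_total (a * T) D with haD | haD <;> rcases le_total (b * T) D with hbD | hbD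
      · exact hll a b a0 haD b0 hbD
      · exact hmixed a b a0 a2 haD b1 hbD
      · rw [dist_comm, abs_sub_comm]
        exact hmixed b a b0 b2 hbD a1 haD
      · exact hrr a b a1 haD b1 hbD

/-- Where shortest paths are unique, they can be extended: the local geodesic that continues a
shortest path a little is close to the shortest path with the same endpoints, hence equal to it. -/
theorem NonposCurvedAtScale.exists_extension [CompactSpace X] (hη : NonposCurvedAtScale X η)
    (hη0 : 0 < η) (hX : IsLengthMetric X) (hE : HasLocalExtensions X) {r : ℝ}
    (hU : UniqueShortestPaths X r) {c : C(I, X)} (hc : c ∈ shortestPaths X)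
    (hD : 0 < dist (c 0) (c 1)) (hr : dist (c 0) (c 1) < r) {κ : ℝ} (hκ : 0 < κ) :
    ∃ c' ∈ shortestPaths X, c' 0 = c 0 ∧ (∃ t : I, c' t = c 1) ∧
      dist (c 0) (c 1) < dist (c' 0) (c' 1) ∧ dist (c' 0) (c' 1) ≤ dist (c 0) (c 1) + κ := by
  obtain ⟨ε, hε, hext⟩ := hE (c 1)
  obtain ⟨δ₀, hδ₀, hclose⟩ := exists_forall_dist_lt_of_unique (c := c) (fun c' hc' h0 h1 =>
    hU _ hc' _ hc h0 h1 (by rwa [h0, h1])) (by positivity : 0 < η / 6)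
  set D := dist (c 0) (c 1) with hDdef
  set s := min D (ε / 2) with hs
  have hs0 : 0 < s := by positivity
  have hsD : s ≤ D := min_le_left _ _
  have hsε : s ≤ ε / 2 := min_le_right _ _
  set w := c ⟨1 - s / D, by linarith [(div_le_one hD).2 hsD],
    by linarith [div_nonneg hs0.le hD.le]⟩ with hw
  have hwq : dist w (c 1) = s := by
    rw [hw, dist_one_of_mem_shortestPaths hc, ← hDdef]
    field_simp
    ring
  set δ := min (min (ε / 2) κ) (min (δ₀ / 2) (η / 12)) with hδ
  have hδpos : 0 < δ := by positivity
  have hδε : δ ≤ ε / 2 := (min_le_left _ _).trans (min_le_left _ _)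
  have hδκ : δ ≤ κ := (min_le_left _ _).trans (min_le_right _ _)
  have hδδ₀ : δ ≤ δ₀ / 2 := (min_le_right _ _).trans (min_le_left _ _)
  have hδη : δ ≤ η / 12 := (min_le_right _ _).trans (min_le_right _ _)
  obtain ⟨q', hq', hwq'⟩ := hext w (by rwa [hwq]) (by rw [hwq]; linarith) δ hδpos (by linarith)
  obtain ⟨e, he, he0, he1⟩ := exists_shortestPath hX (c 1) q'
  have hEδ : dist (e 0) (e 1) = δ := by rw [he0, he1, hq']
  have hcorner : ∀ u v : I, dist (c u) (c 1) ≤ s →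
      dist (c u) (e v) = dist (c u) (c 1) + dist (e 0) (e v) := by
    intro u v hu
    refine le_antisymm ?_ ?_
    · rw [he0]
      exact dist_triangle _ _ _
    · have e1 := dist_one_of_mem_shortestPaths hc u
      have e2 : dist w (c u) = D * |1 - s / D - u| := hc _ u
      have e3 : D * (1 - s / D) = D - s := by field_simp
      rw [← hDdef] at e1
      rw [abs_sub_comm, abs_of_nonneg, mul_sub, e3] at e2
      · have e4 := dist_zero_of_mem_shortestPaths he v
        have e5 := dist_one_of_mem_shortestPaths he v
        rw [hEδ] at e4 e5
        have e6 := dist_triangle4 w (c u) (e v) (e 1)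
        rw [he1, hwq', hwq, ← he1] at e6
        linarith
      · by_contra! hlt
        nlinarith
  obtain ⟨f, hfc, hf, hf1, hf2⟩ := exists_isLocalGeodesic_concat hc he he0.symm hD
    (by rwa [hEδ]) hs0 hcorner
  rw [← hDdef, hEδ] at hf hf1 hf2
  set T := D + δ with hT
  have hT0 : 0 < T := by positivity
  obtain ⟨τ, hτ, hτ0, hτ1⟩ := exists_shortestPath hX (c 0) q'
  have hτc : dist τ c < η / 6 := by
    refine hclose τ hτ (by rwa [hτ0, dist_self]) ?_
    rw [hτ1, dist_comm, hq']
    linarith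
  have hf0 : f 0 = τ 0 := by
    have := hf1 0
    rwa [Set.Icc.coe_zero, zero_mul, zero_div, ← hτ0] at this
  have hf_one : f 1 = τ 1 := by
    have := hf2 1
    rwa [Set.Icc.coe_one, one_mul, ← hT, div_self hT0.ne', he1, ← hτ1] at this
  have hfclose : ∀ t (ht : t ∈ Set.Icc (0 : ℝ) 1), dist (f t) (c ⟨t, ht⟩) ≤ 2 * δ := by
    intro t ht
    rcases le_total (t * T) D with hle | hle
    · have hu : t * T / D ∈ Set.Icc (0 : ℝ) 1 :=
        ⟨div_nonneg (mul_nonneg ht.1 hT0.le) hD.le, (div_le_one hD).2 hle⟩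
      have h1 := hf1 ⟨t * T / D, hu⟩
      rw [show t * T / D * D / T = t by field_simp] at h1
      rw [h1, hc, ← hDdef]
      have h2 : D * |t * T / D - t| = t * δ := by
        have e1 : t * T / D - t = t * δ / D := by rw [hT]; field_simp; ring
        rw [e1, abs_of_nonneg (div_nonneg (mul_nonneg ht.1 hδpos.le) hD.le)]
        field_simp
      rw [h2]
      nlinarith [ht.1, ht.2]
    · have hv : (t * T - D) / δ ∈ Set.Icc (0 : ℝ) 1 :=
        ⟨div_nonneg (by linarith) hδpos.le, (div_le_one hδpos).2 (by nlinarith [ht.2])⟩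
      have h1 := hf2 ⟨(t * T - D) / δ, hv⟩
      rw [show (D + (t * T - D) / δ * δ) / T = t by field_simp; ring] at h1
      have h2 := dist_zero_of_mem_shortestPaths he ⟨(t * T - D) / δ, hv⟩
      have h3 := dist_one_of_mem_shortestPaths hc ⟨t, ht⟩
      rw [hEδ] at h2
      rw [← hDdef] at h3
      have h4 := dist_triangle_left (f t) (c ⟨t, ht⟩) (c 1)
      rw [h1, ← he0, h2, he0, dist_comm (c 1), h3] at h4
      rw [h1]
      have h5 : δ * ((t * T - D) / δ) ≤ δ := mul_le_of_le_one_right hδpos.le hv.2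
      have h6 : D * (1 - t) ≤ δ := by nlinarith [ht.1, ht.2]
      linarith
  have heq : ∀ t : I, f t = τ t := by
    intro t
    have := hη.dist_le_of_isLocalGeodesic hX hfc.continuousOn
      (τ.continuous.Icc_extend').continuousOn hf (isLocalGeodesic_IccExtend hτ)
      (fun t ht => ?_) t t.2
    · rw [Set.IccExtend_of_mem _ _ t.2] at this
      rw [hf0, hf_one] at this
      simpa using this
    · rw [Set.IccExtend_of_mem _ _ ht]
      have h1 := hfclose t ht
      have h2 : dist (τ ⟨t, ht⟩) (c ⟨t, ht⟩) < η / 6 :=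
        (ContinuousMap.dist_apply_le_dist _).trans_lt hτc
      have h3 := dist_triangle_right (f t) (τ ⟨t, ht⟩) (c ⟨t, ht⟩)
      linarith
  have ht : D / T ∈ Set.Icc (0 : ℝ) 1 := ⟨by positivity, (div_le_one hT0).2 (by linarith)⟩
  have hτt : τ ⟨D / T, ht⟩ = c 1 := by
    rw [← heq, ← hf1 1, Set.Icc.coe_one, one_mul]
  have hτT : dist (τ 0) (τ 1) = T := by
    have := dist_zero_of_mem_shortestPaths hτ ⟨D / T, ht⟩
    rw [hτt] at this
    nth_rewrite 1 [hτ0] at this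
    rw [← hDdef] at this
    change D = dist (τ 0) (τ 1) * (D / T) at this
    field_simp at this
    linarith
  refine ⟨τ, hτ, hτ0, ⟨_, hτt⟩, ?_, ?_⟩ <;> rw [hτT] <;> linarith

/-- Where shortest paths are unique, they can be extended to any length. -/
theorem NonposCurvedAtScale.exists_long_extension [CompactSpace X] (hη : NonposCurvedAtScale X η)
    (hη0 : 0 < η) (hX : IsLengthMetric X) (hE : HasLocalExtensions X) {r : ℝ}
    (hU : UniqueShortestPaths X r) {p w : X} {ℓ : ℝ} (hw : 0 < dist p w) (hwℓ : dist p w ≤ ℓ)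
    (hℓ : ℓ < r) :
    ∃ c ∈ shortestPaths X, c 0 = p ∧ dist (c 0) (c 1) = ℓ ∧ ∃ t : I, c t = w := by
  set E : Set (C(I, X) × I) := (shortestPaths X ×ˢ Set.univ) ∩
    ({x | x.1 0 = p} ∩ ({x | dist (x.1 0) (x.1 1) ≤ ℓ} ∩ {x | x.1 x.2 = w})) with hEdef
  have hEc : IsCompact E := by
    refine (isCompact_shortestPaths.prod isCompact_univ).inter_right ?_
    have q1 : IsClosed {x : C(I, X) × I | x.1 0 = p} := isClosed_eq (by fun_prop) (by fun_prop)
    have q2 : IsClosed {x : C(I, X) × I | dist (x.1 0) (x.1 1) ≤ ℓ} :=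
      isClosed_le (by fun_prop) (by fun_prop)
    have q3 : IsClosed {x : C(I, X) × I | x.1 x.2 = w} :=
      isClosed_eq (by fun_prop) (by fun_prop)
    exact q1.inter (q2.inter q3)
  have hEne : E.Nonempty := by
    obtain ⟨c, hc, hc0, hc1⟩ := exists_shortestPath hX p w
    exact ⟨(c, 1), ⟨hc, trivial⟩, hc0, by rwa [Set.mem_ofPred_eq, hc0, hc1], hc1⟩
  obtain ⟨⟨c, t⟩, ⟨⟨hc, -⟩, hc0, hcℓ, hct⟩, hmax⟩ := hEc.exists_isMaxOn hEne
    (f := fun x : C(I, X) × I => dist (x.1 0) (x.1 1)) (Continuous.continuousOn (by fun_prop))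
  simp only [Set.mem_ofPred_eq] at hc0 hcℓ hct
  refine ⟨c, hc, hc0, ?_, t, hct⟩
  by_contra hne
  have hlt := lt_of_le_of_ne hcℓ hne
  have hpos : 0 < dist (c 0) (c 1) := by
    have := dist_zero_of_mem_shortestPaths hc t
    rw [hct] at this
    nth_rewrite 1 [hc0] at this
    rw [this] at hw
    exact pos_of_mul_pos_left hw t.2.1
  obtain ⟨c', hc', h0, ⟨t', ht'⟩, hlong, hshort⟩ :=
    hη.exists_extension hη0 hX hE hU hc hpos (hlt.trans hℓ) (sub_pos.2 hlt)
  have hsub : subpath c' 0 t' = c := by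
    refine hU _ (subpath_mem_shortestPaths hc' _ _) _ hc ?_ ?_ ?_
    · rw [subpath_zero, h0]
    · rw [subpath_one, ht']
    · rw [subpath_zero, subpath_one, h0, ht']
      exact hlt.trans hℓ
  have hmem : (c', t * t') ∈ E := by
    refine ⟨⟨hc', trivial⟩, h0.trans hc0, ?_, ?_⟩
    · rw [Set.mem_ofPred_eq]
      linarith
    · rw [Set.mem_ofPred_eq, ← hct, ← hsub]
      exact (subpath_apply c' 0 t' t (t * t') (by simp)).symm
  have : dist (c' 0) (c' 1) ≤ dist (c 0) (c 1) := hmax hmem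
  linarith

/-- Where shortest paths are unique, the contraction towards `p` by the factor `t` is locally
`t`-Lipschitz. -/
theorem NonposCurvedAtScale.exists_dist_le_mul [CompactSpace X] (hη : NonposCurvedAtScale X η)
    (hη0 : 0 < η) (hX : IsLengthMetric X) {r : ℝ} (hU : UniqueShortestPaths X r) {p y : X}
    (hy : dist p y < r) :
    ∃ δ > 0, ∀ c ∈ shortestPaths X, ∀ c' ∈ shortestPaths X, c 0 = p → c' 0 = p →
      dist (c 1) y < δ → dist (c' 1) y < δ → ∀ t : I, dist (c t) (c' t) ≤ t * dist (c 1) (c' 1) := by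
  obtain ⟨e, he, he0, he1⟩ := exists_shortestPath hX p y
  obtain ⟨δ, hδ, hclose⟩ := exists_forall_dist_lt_of_unique (c := e) (fun c' hc' h0 h1 =>
    hU _ hc' _ he h0 h1 (by rwa [h0, h1, he0, he1])) (by positivity : 0 < η / 6)
  refine ⟨δ, hδ, fun c hc c' hc' h0 h0' h1 h1' t => ?_⟩
  have d1 := hclose c hc (by rwa [h0, he0, dist_self]) (by rwa [he1])
  have d2 := hclose c' hc' (by rwa [h0', he0, dist_self]) (by rwa [he1])
  have := hη.dist_le_of_mem_shortestPaths hX hc hc'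
    (by linarith [dist_triangle_right c c' e]) t
  simpa [h0, h0'] using this

end Extension

/-! ### Areas of balls -/

section Area

open MeasureTheory

theorem LipschitzOnWith.euclideanHausdorffMeasure_image_le {X Y : Type*} [MetricSpace X]
    [MeasurableSpace X] [BorelSpace X] [MetricSpace Y] [MeasurableSpace Y] [BorelSpace Y]
    {K : NNReal} {f : X → Y} {s : Set X} (h : LipschitzOnWith K f s) (d : ℕ) :
    (μHE[d] : Measure Y) (f '' s) ≤ (K : ℝ≥0∞) ^ d * (μHE[d] : Measure X) s := by
  rw [Measure.euclideanHausdorffMeasure_def, Measure.euclideanHausdorffMeasure_def,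
    Measure.smul_apply, Measure.smul_apply, ENNReal.smul_def, ENNReal.smul_def, smul_eq_mul,
    smul_eq_mul, mul_left_comm]
  gcongr
  simpa using h.hausdorffMeasure_image_le (d := d) (by positivity)

/-- Maps that are locally `K`-Lipschitz on a measurable set increase the `d`-dimensional measure at
most by the factor `K ^ d`. -/
theorem euclideanHausdorffMeasure_image_le_of_locally {X Y : Type*} [MetricSpace X]
    [SecondCountableTopology X] [MeasurableSpace X] [BorelSpace X] [MetricSpace Y]
    [MeasurableSpace Y] [BorelSpace Y] {K : NNReal} {f : X → Y} {s : Set X}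
    (hs : MeasurableSet s)
    (h : ∀ x ∈ s, ∃ δ > 0, LipschitzOnWith K f (s ∩ Metric.ball x δ)) (d : ℕ) :
    (μHE[d] : Measure Y) (f '' s) ≤ (K : ℝ≥0∞) ^ d * (μHE[d] : Measure X) s := by
  choose! δ hδ hL using h
  obtain ⟨t, hts, htc, hcov⟩ := TopologicalSpace.countable_cover_nhdsWithin
    (f := fun x => Metric.ball x (δ x)) (s := s)
    fun x hx => mem_nhdsWithin_of_mem_nhds (Metric.ball_mem_nhds x (hδ x hx))
  rcases t.eq_empty_or_nonempty with rfl | htne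
  · have : s = ∅ := by simpa using hcov
    simp [this]
  obtain ⟨x, rfl⟩ := htc.exists_eq_range htne
  set B : ℕ → Set X := fun n => Metric.ball (x n) (δ (x n)) with hB
  have hsub : s = ⋃ n, s ∩ disjointed B n := by
    rw [← Set.inter_iUnion, iUnion_disjointed, eq_comm, Set.inter_eq_left]
    simpa using hcov
  have hmeas : ∀ n, MeasurableSet (s ∩ disjointed B n) := fun n =>
    hs.inter (MeasurableSet.disjointed (fun n => Metric.isOpen_ball.measurableSet) n)
  have hdisj : Pairwise (Function.onFun Disjoint fun n => s ∩ disjointed B n) := fun i j hij =>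
    (disjoint_disjointed B hij).mono Set.inter_subset_right Set.inter_subset_right
  calc (μHE[d] : Measure Y) (f '' s)
      = (μHE[d] : Measure Y) (⋃ n, f '' (s ∩ disjointed B n)) := by
        rw [← Set.image_iUnion, ← hsub]
    _ ≤ ∑' n, (μHE[d] : Measure Y) (f '' (s ∩ disjointed B n)) := measure_iUnion_le _
    _ ≤ ∑' n, (K : ℝ≥0∞) ^ d * (μHE[d] : Measure X) (s ∩ disjointed B n) := by
        refine ENNReal.tsum_le_tsum fun n => ?_
        refine LipschitzOnWith.euclideanHausdorffMeasure_image_le ?_ d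
        exact (hL (x n) (hts ⟨n, rfl⟩)).mono
          (Set.inter_subset_inter_right s (disjointed_subset B n))
    _ = (K : ℝ≥0∞) ^ d * (μHE[d] : Measure X) s := by
        rw [ENNReal.tsum_mul_left, ← measure_iUnion hdisj hmeas, ← hsub]

variable {X : Type u} [MetricSpace X] [MeasurableSpace X] [BorelSpace X] {η : ℝ}

/-- In nonpositive curvature, the area of a ball in which shortest paths from the center are unique
grows at least quadratically: the contraction by the factor `t` towards the center maps the ball
onto the ball of radius `t * r`, and it is locally `t`-Lipschitz. -/
theorem NonposCurvedAtScale.area_ball_mul_le [CompactSpace X] (hη : NonposCurvedAtScale X η)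
    (hη0 : 0 < η) (hX : IsLengthMetric X) (hE : HasLocalExtensions X) {r : ℝ}
    (hU : UniqueShortestPaths X r) (p : X) {t : I} (ht : 0 < (t : ℝ)) :
    (μHE[2] : Measure X) (Metric.ball p (t * r)) ≤
      ENNReal.ofReal t ^ 2 * (μHE[2] : Measure X) (Metric.ball p r) := by
  choose c hc hc0 hc1 using exists_shortestPath hX p
  have hsurj : Metric.ball p (t * r) ⊆ (fun y => c y t) '' Metric.ball p r := by
    intro w hw
    rw [Metric.mem_ball, dist_comm] at hw
    rcases (dist_nonneg (x := p) (y := w)).eq_or_lt with h0 | hpos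
    · have hpw : p = w := dist_eq_zero.1 h0.symm
      subst hpw
      refine ⟨p, ?_, ?_⟩
      · rw [Metric.mem_ball, dist_self]
        rw [dist_self] at hw
        exact pos_of_mul_pos_right hw ht.le
      · have := dist_zero_of_mem_shortestPaths (hc p) t
        rw [hc0, hc1, dist_self, zero_mul, dist_eq_zero] at this
        exact this.symm
    · have hlt : dist p w / t < r := (div_lt_iff₀' ht).2 hw
      obtain ⟨e, he, he0, hel, s, hs⟩ := hη.exists_long_extension hη0 hX hE hU hpos
        (le_div_self hpos.le ht t.2.2) hlt
      have hst : s = t := by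
        have := dist_zero_of_mem_shortestPaths he s
        rw [hel, hs, he0] at this
        refine Subtype.ext ?_
        field_simp at this
        linarith
      subst hst
      have hmem : dist p (e 1) < r := by rwa [← he0, hel]
      refine ⟨e 1, by rwa [Metric.mem_ball, dist_comm], ?_⟩
      rw [← hs]
      exact DFunLike.congr_fun (hU _ (hc _) _ he (by rw [hc0, he0]) (hc1 _)
        (by rwa [hc0, hc1])) s
  refine (measure_mono hsurj).trans ?_
  have := euclideanHausdorffMeasure_image_le_of_locally (K := ⟨t, t.2.1⟩)
    (f := fun y => c y t) (Metric.isOpen_ball (x := p) (ε := r)).measurableSet (fun y hy => ?_) 2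
  · rwa [ENNReal.ofReal_eq_coe_nnreal t.2.1]
  · rw [Metric.mem_ball, dist_comm] at hy
    obtain ⟨δ, hδ, hle⟩ := hη.exists_dist_le_mul hη0 hX hU hy
    refine ⟨δ, hδ, LipschitzOnWith.of_dist_le_mul fun a ha b hb => ?_⟩
    have := hle _ (hc a) _ (hc b) (hc0 a) (hc0 b) (by rw [hc1]; exact ha.2)
      (by rw [hc1]; exact hb.2) t
    rw [hc1, hc1] at this
    exact this

end Area

/-! ### Euclidean cones -/

section Cone

/-- The angle, at most `π`, that enters the law of cosines in `coneDist`. -/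
noncomputable def cutAngle (m : ℕ) (θ φ : ℝ) : ℝ :=
  min π ‖((θ - φ : ℝ) : AddCircle (2 * π * m))‖

theorem cutAngle_nonneg (m : ℕ) (θ φ : ℝ) : 0 ≤ cutAngle m θ φ :=
  le_min Real.pi_pos.le (norm_nonneg _)

theorem cutAngle_le_pi (m : ℕ) (θ φ : ℝ) : cutAngle m θ φ ≤ π := min_le_left _ _

theorem cutAngle_comm (m : ℕ) (θ φ : ℝ) : cutAngle m θ φ = cutAngle m φ θ := by
  rw [cutAngle, cutAngle, ← norm_neg, ← AddCircle.coe_neg, neg_sub]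

theorem coneDist_comm (m : ℕ) (r θ s φ : ℝ) : coneDist m r θ s φ = coneDist m s φ r θ := by
  have h := cutAngle_comm m θ φ
  simp only [cutAngle] at h
  rw [coneDist, coneDist, h]
  congr 1
  ring

theorem coneDist_sq (m : ℕ) {r s : ℝ} (hr : 0 ≤ r) (hs : 0 ≤ s) (θ φ : ℝ) :
    coneDist m r θ s φ ^ 2 = r ^ 2 + s ^ 2 - 2 * r * s * Real.cos (cutAngle m θ φ) := by
  rw [coneDist, Real.sq_sqrt, cutAngle]
  have := Real.cos_le_one (min π ‖((θ - φ : ℝ) : AddCircle (2 * π * m))‖)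
  nlinarith [mul_nonneg hr hs, sq_nonneg (r - s)]

theorem coneDist_nonneg (m : ℕ) (r θ s φ : ℝ) : 0 ≤ coneDist m r θ s φ := Real.sqrt_nonneg _

theorem coneDist_le_add (m : ℕ) {r s : ℝ} (hr : 0 ≤ r) (hs : 0 ≤ s) (θ φ : ℝ) :
    coneDist m r θ s φ ≤ r + s := by
  refine (pow_le_pow_iff_left₀ (coneDist_nonneg _ _ _ _ _) (by positivity) two_ne_zero).1 ?_
  rw [coneDist_sq m hr hs]
  nlinarith [Real.neg_one_le_cos (cutAngle m θ φ), mul_nonneg hr hs]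

theorem coneDist_eq_add (m : ℕ) {r s : ℝ} (hr : 0 ≤ r) (hs : 0 ≤ s) {θ φ : ℝ}
    (h : cutAngle m θ φ = π) : coneDist m r θ s φ = r + s := by
  refine (pow_left_inj₀ (coneDist_nonneg _ _ _ _ _) (by positivity) two_ne_zero).1 ?_
  rw [coneDist_sq m hr hs, h, Real.cos_pi]
  ring

theorem sub_mul_cos_le_coneDist (m : ℕ) {r s : ℝ} (hr : 0 ≤ r) (hs : 0 ≤ s) (θ φ : ℝ) :
    r - s * Real.cos (cutAngle m θ φ) ≤ coneDist m r θ s φ := by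
  refine le_of_sq_le_sq ?_ (coneDist_nonneg _ _ _ _ _)
  rw [coneDist_sq m hr hs]
  nlinarith [sq_nonneg s, Real.sin_sq_add_cos_sq (cutAngle m θ φ),
    mul_nonneg (sq_nonneg s) (sq_nonneg (Real.sin (cutAngle m θ φ)))]

theorem coneDist_zero_right (m : ℕ) {r : ℝ} (hr : 0 ≤ r) (θ φ : ℝ) : coneDist m r θ 0 φ = r := by
  refine (pow_left_inj₀ (coneDist_nonneg _ _ _ _ _) hr two_ne_zero).1 ?_
  rw [coneDist_sq m hr le_rfl]
  ring

theorem dist_polarPoint_sq (r θ s φ : ℝ) :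
    dist (polarPoint r θ) (polarPoint s φ) ^ 2 = r ^ 2 + s ^ 2 - 2 * r * s * Real.cos (θ - φ) := by
  rw [dist_eq_norm, ← Complex.normSq_eq_norm_sq, Complex.normSq_apply, polarPoint, polarPoint]
  simp only [Complex.exp_mul_I, ← Complex.ofReal_cos, ← Complex.ofReal_sin, Complex.sub_re,
    Complex.sub_im, Complex.mul_re, Complex.mul_im, Complex.add_re, Complex.add_im,
    Complex.ofReal_re, Complex.ofReal_im, Complex.I_re, Complex.I_im, Real.cos_sub]
  nlinarith [Real.sin_sq_add_cos_sq θ, Real.sin_sq_add_cos_sq φ]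

theorem dist_polarPoint_le_coneDist_of_cos_le {m : ℕ} {r s θ φ θ' φ' : ℝ} (hr : 0 ≤ r)
    (hs : 0 ≤ s) (h : Real.cos (cutAngle m θ φ) ≤ Real.cos (θ' - φ')) :
    dist (polarPoint r θ') (polarPoint s φ') ≤ coneDist m r θ s φ := by
  refine le_of_sq_le_sq ?_ (coneDist_nonneg _ _ _ _ _)
  rw [coneDist_sq m hr hs, dist_polarPoint_sq]
  nlinarith [mul_nonneg hr hs]

theorem coneDist_le_dist_polarPoint_of_cos_le {m : ℕ} {r s θ φ θ' φ' : ℝ} (hr : 0 ≤ r)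
    (hs : 0 ≤ s) (h : Real.cos (θ' - φ') ≤ Real.cos (cutAngle m θ φ)) :
    coneDist m r θ s φ ≤ dist (polarPoint r θ') (polarPoint s φ') := by
  refine le_of_sq_le_sq ?_ dist_nonneg
  rw [coneDist_sq m hr hs, dist_polarPoint_sq]
  nlinarith [mul_nonneg hr hs]

theorem dist_polarPoint_eq_coneDist_of_cos_eq {m : ℕ} {r s θ φ θ' φ' : ℝ} (hr : 0 ≤ r)
    (hs : 0 ≤ s) (h : Real.cos (cutAngle m θ φ) = Real.cos (θ' - φ')) :
    dist (polarPoint r θ') (polarPoint s φ') = coneDist m r θ s φ :=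
  le_antisymm (dist_polarPoint_le_coneDist_of_cos_le hr hs h.le)
    (coneDist_le_dist_polarPoint_of_cos_le hr hs h.ge)

theorem norm_coe_addCircle_le_abs {p : ℝ} (hp : 0 < p) (x : ℝ) :
    ‖(x : AddCircle p)‖ ≤ |x| := by
  rw [AddCircle.norm_eq' p hp]
  have := round_le (p⁻¹ * x) 0
  rw [Int.cast_zero, sub_zero, abs_mul, abs_of_pos (inv_pos.2 hp)] at this
  calc p * |p⁻¹ * x - round (p⁻¹ * x)| ≤ p * (p⁻¹ * |x|) := by gcongr
    _ = |x| := by field_simp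

theorem cos_min_pi_le_cos {N g : ℝ} (h : |g| ≤ N) : Real.cos (min π N) ≤ Real.cos g := by
  rcases le_total π N with hN | hN
  · rw [min_eq_left hN, Real.cos_pi]
    exact Real.neg_one_le_cos g
  · rw [min_eq_right hN, ← Real.cos_abs g]
    exact Real.cos_le_cos_of_nonneg_of_le_pi (abs_nonneg g) hN h

/-- The map `(r, θ) ↦ r * exp (iθ)` from the cone to the plane is 1-Lipschitz. -/
theorem dist_polarPoint_le_coneDist (m : ℕ) {r s : ℝ} (hr : 0 ≤ r) (hs : 0 ≤ s) (θ φ : ℝ) :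
    dist (polarPoint r θ) (polarPoint s φ) ≤ coneDist m r θ s φ := by
  refine dist_polarPoint_le_coneDist_of_cos_le hr hs ?_
  rw [cutAngle, AddCircle.norm_eq]
  have := cos_min_pi_le_cos
    (le_refl |θ - φ - round ((2 * π * m)⁻¹ * (θ - φ)) * (2 * π * m)|)
  convert this using 1
  rw [show θ - φ - round ((2 * π * m)⁻¹ * (θ - φ)) * (2 * π * m) =
    θ - φ - ((round ((2 * π * m)⁻¹ * (θ - φ)) * m : ℤ) : ℝ) * (2 * π) by push_cast; ring,
    Real.cos_sub_int_mul_two_pi]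

/-- The representative of an angle modulo `2πm` in `[-πm, πm]`. -/
noncomputable def angleRep (m : ℕ) (θ : ℝ) : ℝ :=
  θ - round ((2 * π * m)⁻¹ * θ) * (2 * π * m)

/-- The representative of an angle modulo `2πm` in `[-πm, πm]`, cut off at `-π` and `π`. -/
noncomputable def foldAngle (m : ℕ) (θ : ℝ) : ℝ := max (-π) (min π (angleRep m θ))

theorem abs_angleRep (m : ℕ) (θ : ℝ) : |angleRep m θ| = ‖(θ : AddCircle (2 * π * m))‖ := by
  rw [AddCircle.norm_eq, angleRep]

theorem abs_angleRep_le {m : ℕ} (hm : 0 < m) (θ : ℝ) : |angleRep m θ| ≤ π * m := by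
  have hp : 0 < 2 * π * m := by positivity
  rw [abs_angleRep]
  refine (AddCircle.norm_le_half_period _ hp.ne').trans ?_
  rw [abs_of_pos hp]
  linarith

theorem coe_angleRep (m : ℕ) (θ : ℝ) :
    (angleRep m θ : AddCircle (2 * π * m)) = (θ : AddCircle (2 * π * m)) := by
  rw [angleRep, AddCircle.coe_sub, sub_eq_self, ← zsmul_eq_mul, AddCircle.coe_zsmul,
    AddCircle.coe_period, smul_zero]

theorem foldAngle_cases (m : ℕ) (θ : ℝ) :
    (|angleRep m θ| ≤ π ∧ foldAngle m θ = angleRep m θ) ∨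
      (π ≤ angleRep m θ ∧ foldAngle m θ = π) ∨ (angleRep m θ ≤ -π ∧ foldAngle m θ = -π) := by
  have hπ := Real.pi_pos
  rcases le_total π (angleRep m θ) with h | h
  · refine Or.inr (Or.inl ⟨h, ?_⟩)
    rw [foldAngle, min_eq_left h, max_eq_right (by linarith)]
  · rcases le_total (angleRep m θ) (-π) with h' | h'
    · refine Or.inr (Or.inr ⟨h', ?_⟩)
      rw [foldAngle, min_eq_right h, max_eq_left h']
    · refine Or.inl ⟨abs_le.2 ⟨h', h⟩, ?_⟩
      rw [foldAngle, min_eq_right h, max_eq_right h']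

theorem abs_foldAngle (m : ℕ) (θ φ : ℝ) : |foldAngle m (θ - φ)| = cutAngle m θ φ := by
  have hπ := Real.pi_pos
  rw [cutAngle, ← abs_angleRep]
  rcases foldAngle_cases m (θ - φ) with ⟨h, h'⟩ | ⟨h, h'⟩ | ⟨h, h'⟩
  · rw [h', min_eq_right h]
  · rw [h', abs_of_pos hπ, min_eq_left (h.trans (le_abs_self _))]
  · rw [h', abs_neg, abs_of_pos hπ, min_eq_left]
    exact (by linarith : π ≤ -angleRep m (θ - φ)).trans (neg_le_abs _)

/-- The folding of the circle of length `2πm` to the circle of length `2π` which is the identity on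
the angles up to `π` and maps the other ones to `π` is 1-Lipschitz. -/
theorem cos_cutAngle_le_cos_foldAngle {m : ℕ} (hm : 0 < m) (θ φ χ : ℝ) :
    Real.cos (cutAngle m θ φ) ≤ Real.cos (foldAngle m (θ - χ) - foldAngle m (φ - χ)) := by
  have hπ := Real.pi_pos
  have hm1 : (1 : ℝ) ≤ m := by exact_mod_cast hm
  have hα := abs_le.1 (abs_angleRep_le hm (θ - χ))
  have hβ := abs_le.1 (abs_angleRep_le hm (φ - χ))
  have hnorm : ((θ - φ : ℝ) : AddCircle (2 * π * m)) =
      ((angleRep m (θ - χ) - angleRep m (φ - χ) : ℝ) : AddCircle (2 * π * m)) := by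
    rw [AddCircle.coe_sub (p := 2 * π * m) (angleRep m (θ - χ)), coe_angleRep, coe_angleRep,
      ← AddCircle.coe_sub]
    congr 1
    ring
  have hπm : π ≤ π * m := le_mul_of_one_le_right hπ.le hm1
  have hlip : |foldAngle m (θ - χ) - foldAngle m (φ - χ)| ≤
      |angleRep m (θ - χ) - angleRep m (φ - χ)| ∧
      |angleRep m (θ - χ) - angleRep m (φ - χ)| ≤
        |foldAngle m (θ - χ) - foldAngle m (φ - χ)| + (2 * π * m - 2 * π) ∧
      |foldAngle m (θ - χ) - foldAngle m (φ - χ)| ≤ 2 * π := by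
    have b1 := le_abs_self (angleRep m (θ - χ) - angleRep m (φ - χ))
    have b2 := neg_le_abs (angleRep m (θ - χ) - angleRep m (φ - χ))
    have b3 := le_abs_self (foldAngle m (θ - χ) - foldAngle m (φ - χ))
    have b4 := neg_le_abs (foldAngle m (θ - χ) - foldAngle m (φ - χ))
    rcases foldAngle_cases m (θ - χ) with ⟨h, h'⟩ | ⟨h, h'⟩ | ⟨h, h'⟩ <;>
    rcases foldAngle_cases m (φ - χ) with ⟨k, k'⟩ | ⟨k, k'⟩ | ⟨k, k'⟩ <;>
    rw [h', k'] at b3 b4 ⊢ <;>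
    (try rw [abs_le] at h) <;> (try rw [abs_le] at k) <;>
    refine ⟨abs_le.2 ⟨?_, ?_⟩, abs_le.2 ⟨?_, ?_⟩, abs_le.2 ⟨?_, ?_⟩⟩ <;> linarith
  obtain ⟨l1, l2, l3⟩ := hlip
  rw [cutAngle, hnorm, AddCircle.norm_eq]
  set D := angleRep m (θ - χ) - angleRep m (φ - χ)
  set g := foldAngle m (θ - χ) - foldAngle m (φ - χ)
  set j := round ((2 * π * m)⁻¹ * D)
  rcases eq_or_ne j 0 with hj | hj
  · rw [hj, Int.cast_zero, zero_mul, sub_zero]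
    exact cos_min_pi_le_cos l1
  · rw [← Real.cos_abs g, ← Real.cos_two_pi_sub |g|]
    refine cos_min_pi_le_cos ?_
    rw [abs_of_nonneg (by linarith)]
    have hj1 : (1 : ℝ) ≤ |(j : ℝ)| := by exact_mod_cast Int.one_le_abs hj
    have h1 : 2 * π * m ≤ |(j : ℝ) * (2 * π * m)| := by
      rw [abs_mul, abs_of_pos (by positivity : 0 < 2 * π * (m : ℝ))]
      exact le_mul_of_one_le_left (by positivity) hj1
    have h2 := abs_sub_abs_le_abs_sub ((j : ℝ) * (2 * π * m)) D
    rw [abs_sub_comm ((j : ℝ) * (2 * π * m)) D] at h2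
    linarith

/-- The law of cosines in the plane gives the inequality of Bruhat and Tits with equality. -/
theorem dist_sq_eq_of_midpoint {x y z m : ℂ} (h1 : dist y m = dist y z / 2)
    (h2 : dist m z = dist y z / 2) :
    dist x m ^ 2 = dist x y ^ 2 / 2 + dist x z ^ 2 / 2 - dist y z ^ 2 / 4 := by
  have := EuclideanGeometry.dist_sq_add_dist_sq_eq_two_mul_dist_midpoint_sq_add_half_dist_sq x y z
  rw [eq_midpoint_of_dist_eq_half h1 h2]
  linarith

/-- Euclidean cones of angle `2πm`, `m ≥ 1`, have nonpositive curvature. If the midpoint is not the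
vertex, then the folding of the cone to the plane that preserves the distances to the midpoint
reduces this to the parallelogram identity. -/
theorem coneDist_bruhatTits {m : ℕ} (hm : 0 < m) {ρ r s μ : ℝ} (hρ : 0 ≤ ρ) (hr : 0 ≤ r)
    (hs : 0 ≤ s) (hμ : 0 ≤ μ) (α θ φ χ : ℝ)
    (h1 : coneDist m r θ μ χ = coneDist m r θ s φ / 2)
    (h2 : coneDist m μ χ s φ = coneDist m r θ s φ / 2) :
    coneDist m ρ α μ χ ^ 2 ≤ coneDist m ρ α r θ ^ 2 / 2 + coneDist m ρ α s φ ^ 2 / 2 -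
      coneDist m r θ s φ ^ 2 / 4 := by
  have hπ := Real.pi_pos
  have hp : 0 < 2 * π * (m : ℝ) := by positivity
  rcases hμ.eq_or_lt with rfl | hμ
  · -- the midpoint is the vertex: the segment makes an angle of at least `π` there
    rw [coneDist_zero_right m hr] at h1
    rw [coneDist_comm, coneDist_zero_right m hs] at h2
    have hrs : r = s := by linarith
    subst hrs
    have hsq := coneDist_sq m hr hr θ φ
    rw [show coneDist m r θ r φ = 2 * r by linarith] at hsq ⊢
    rw [coneDist_zero_right m hρ, coneDist_sq m hρ hr, coneDist_sq m hρ hr]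
    rcases hr.eq_or_lt with rfl | hr0
    · nlinarith
    have hcos : Real.cos (cutAngle m θ φ) = -1 := by
      have : 0 < r ^ 2 := by positivity
      nlinarith
    have hcut : cutAngle m θ φ = π :=
      Real.injOn_cos ⟨cutAngle_nonneg _ _ _, cutAngle_le_pi _ _ _⟩ ⟨hπ.le, le_rfl⟩
        (by rw [hcos, Real.cos_pi])
    have hsum : π ≤ cutAngle m α θ + cutAngle m α φ := by
      have h3 : π ≤ ‖((θ - φ : ℝ) : AddCircle (2 * π * m))‖ :=
        hcut.ge.trans (min_le_right _ _)
      have h4 : ‖((θ - φ : ℝ) : AddCircle (2 * π * m))‖ ≤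
          ‖((α - θ : ℝ) : AddCircle (2 * π * m))‖ + ‖((α - φ : ℝ) : AddCircle (2 * π * m))‖ := by
        rw [show θ - φ = (α - φ) - (α - θ) by ring, AddCircle.coe_sub, add_comm]
        exact norm_sub_le _ _
      have n1 := norm_nonneg ((α - θ : ℝ) : AddCircle (2 * π * m))
      have n2 := norm_nonneg ((α - φ : ℝ) : AddCircle (2 * π * m))
      simp only [cutAngle]
      rcases min_cases π ‖((α - θ : ℝ) : AddCircle (2 * π * m))‖ with ⟨e, -⟩ | ⟨e, -⟩ <;>
      rcases min_cases π ‖((α - φ : ℝ) : AddCircle (2 * π * m))‖ with ⟨e', -⟩ | ⟨e', -⟩ <;>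
      rw [e, e'] <;> linarith
    have hle : Real.cos (cutAngle m α φ) ≤ -Real.cos (cutAngle m α θ) := by
      rw [← Real.cos_pi_sub]
      exact Real.cos_le_cos_of_nonneg_of_le_pi (by linarith [cutAngle_le_pi m α θ])
        (cutAngle_le_pi _ _ _) (by linarith)
    nlinarith [mul_nonneg hρ hr]
  -- the two angles at the midpoint's ray sum up to at most `π`
  have hangle : cutAngle m θ χ + cutAngle m φ χ ≤ π := by
    have e1 := sub_mul_cos_le_coneDist m hr hμ.le θ χ
    have e2 := sub_mul_cos_le_coneDist m hs hμ.le φ χ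
    have e3 := coneDist_le_add m hr hs θ φ
    rw [coneDist_comm m μ] at h2
    have e4 : 0 ≤ Real.cos (cutAngle m θ χ) + Real.cos (cutAngle m φ χ) := by
      by_contra! hlt
      nlinarith
    by_contra! hlt
    have e5 := Real.cos_lt_cos_of_nonneg_of_le_pi (x := π - cutAngle m θ χ)
      (by linarith [cutAngle_le_pi m θ χ]) (cutAngle_le_pi m φ χ) (by linarith)
    rw [Real.cos_pi_sub] at e5
    linarith
  have hfold : ∀ {t : ℝ} (ht : 0 ≤ t) (β : ℝ),
      dist (polarPoint t (foldAngle m (β - χ))) (polarPoint μ 0) = coneDist m t β μ χ := by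
    intro t ht β
    refine dist_polarPoint_eq_coneDist_of_cos_eq ht hμ.le ?_
    rw [sub_zero, ← Real.cos_abs (foldAngle m (β - χ)), abs_foldAngle]
  have hlip : ∀ {t t' : ℝ} (ht : 0 ≤ t) (ht' : 0 ≤ t') (β β' : ℝ),
      dist (polarPoint t (foldAngle m (β - χ))) (polarPoint t' (foldAngle m (β' - χ))) ≤
        coneDist m t β t' β' := fun ht ht' β β' =>
    dist_polarPoint_le_coneDist_of_cos_le ht ht' (cos_cutAngle_le_cos_foldAngle hm _ _ _)
  have hyz : dist (polarPoint r (foldAngle m (θ - χ))) (polarPoint s (foldAngle m (φ - χ))) =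
      coneDist m r θ s φ := by
    refine le_antisymm (hlip hr hs θ φ) (coneDist_le_dist_polarPoint_of_cos_le hr hs ?_)
    rw [← abs_foldAngle, ← abs_foldAngle] at hangle
    have hopp : |foldAngle m (θ - χ) - foldAngle m (φ - χ)| = π →
        Real.cos (foldAngle m (θ - χ) - foldAngle m (φ - χ)) ≤ Real.cos (cutAngle m θ φ) := by
      intro h
      rw [← Real.cos_abs, h, Real.cos_pi]
      exact Real.neg_one_le_cos _
    have hzero : ∀ {x : ℝ}, π + |x| ≤ π → x = 0 := fun h => abs_nonpos_iff.1 (by linarith)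
    rcases foldAngle_cases m (θ - χ) with ⟨-, h'⟩ | ⟨-, h'⟩ | ⟨-, h'⟩
    · rcases foldAngle_cases m (φ - χ) with ⟨-, k'⟩ | ⟨-, k'⟩ | ⟨-, k'⟩
      · rw [h', k'] at hangle ⊢
        have hle : |angleRep m (θ - χ) - angleRep m (φ - χ)| ≤ π := (abs_sub _ _).trans hangle
        rw [← Real.cos_abs]
        refine Real.cos_le_cos_of_nonneg_of_le_pi (cutAngle_nonneg _ _ _) hle ?_
        refine (min_le_right _ _).trans ?_
        have hnorm : ((θ - φ : ℝ) : AddCircle (2 * π * m)) =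
            ((angleRep m (θ - χ) - angleRep m (φ - χ) : ℝ) : AddCircle (2 * π * m)) := by
          rw [AddCircle.coe_sub (p := 2 * π * m) (angleRep m (θ - χ)), coe_angleRep,
            coe_angleRep, ← AddCircle.coe_sub]
          congr 1
          ring
        rw [hnorm]
        exact norm_coe_addCircle_le_abs hp _
      · refine hopp ?_
        rw [k', abs_of_pos hπ, add_comm] at hangle
        rw [hzero hangle, k', zero_sub, abs_neg, abs_of_pos hπ]
      · refine hopp ?_
        rw [k', abs_neg, abs_of_pos hπ, add_comm] at hangle
        rw [hzero hangle, k', zero_sub, neg_neg, abs_of_pos hπ]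
    · refine hopp ?_
      rw [h', abs_of_pos hπ] at hangle
      rw [hzero hangle, h', sub_zero, abs_of_pos hπ]
    · refine hopp ?_
      rw [h', abs_neg, abs_of_pos hπ] at hangle
      rw [hzero hangle, h', sub_zero, abs_neg, abs_of_pos hπ]
  have key := dist_sq_eq_of_midpoint (x := polarPoint ρ (foldAngle m (α - χ)))
    (y := polarPoint r (foldAngle m (θ - χ))) (z := polarPoint s (foldAngle m (φ - χ)))
    (m := polarPoint μ 0) (by rw [hfold hr, hyz, h1])
    (by rw [dist_comm, hfold hs, hyz, coneDist_comm, h2])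
  rw [hfold hρ, hyz] at key
  have l1 := pow_le_pow_left₀ dist_nonneg (hlip hρ hr α θ) 2
  have l2 := pow_le_pow_left₀ dist_nonneg (hlip hρ hs α φ) 2
  linarith

end Cone

/-! ### The local geometry of translation surfaces -/

section LocalGeometry

/-- A translation chart maps a ball around a regular point `q` isometrically onto a disc. -/
theorem TranslationSurface.exists_disc (S : TranslationSurface.{u}) {q : S.carrier}
    (hq : S.order q = 0) : ∃ (e : S.carrier → ℂ) (ε : ℝ), 0 < ε ∧
      (∀ x ∈ Metric.ball q ε, ∀ y ∈ Metric.ball q ε, dist (e x) (e y) = dist x y) ∧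
      ∀ z, dist z (e q) < ε → ∃ x ∈ Metric.ball q ε, e x = z := by
  have hmem : q ∈ ⋃ e ∈ S.atlas, e.source := by
    rw [S.iUnion_source]
    exact hq
  simp only [Set.mem_iUnion] at hmem
  obtain ⟨e, he, hqe⟩ := hmem
  obtain ⟨U, hU, hiso⟩ := S.chart_isometry e he q hqe
  obtain ⟨ε₁, hε₁, hball⟩ := Metric.mem_nhds_iff.1 (Filter.inter_mem hU
    (e.open_source.mem_nhds hqe))
  have himg : e '' Metric.ball q ε₁ ∈ 𝓝 (e q) :=
    e.image_mem_nhds hqe (Metric.ball_mem_nhds q hε₁)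
  obtain ⟨ε₂, hε₂, hball₂⟩ := Metric.mem_nhds_iff.1 himg
  refine ⟨e, min ε₁ ε₂, lt_min hε₁ hε₂, fun x hx y hy => ?_, fun z hz => ?_⟩
  · exact hiso x (hball (Metric.ball_subset_ball (min_le_left _ _) hx)).1 y
      (hball (Metric.ball_subset_ball (min_le_left _ _) hy)).1
  · obtain ⟨x, hx, rfl⟩ := hball₂ (Metric.mem_ball.2 (hz.trans_le (min_le_right _ _)))
    refine ⟨x, ?_, rfl⟩
    rwa [hiso x (hball hx).1 q (hball (Metric.mem_ball_self hε₁)).1] at hz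

theorem TranslationSurface.exists_nonposCurvedAtScale (S : TranslationSurface.{u}) :
    ∃ η > 0, NonposCurvedAtScale S.carrier η := by
  have hloc : ∀ q : S.carrier, ∃ ε > 0, ∀ x ∈ Metric.ball q ε, ∀ y ∈ Metric.ball q ε,
      ∀ z ∈ Metric.ball q ε, ∀ m ∈ Metric.ball q ε, dist y m = dist y z / 2 →
      dist m z = dist y z / 2 →
      dist x m ^ 2 ≤ dist x y ^ 2 / 2 + dist x z ^ 2 / 2 - dist y z ^ 2 / 4 := by
    intro q
    by_cases hq : S.order q = 0
    · obtain ⟨e, ε, hε, hiso, -⟩ := S.exists_disc hq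
      refine ⟨ε, hε, fun x hx y hy z hz m hm h1 h2 => ?_⟩
      rw [← hiso y hy m hm, ← hiso y hy z hz] at h1
      rw [← hiso m hm z hz, ← hiso y hy z hz] at h2
      rw [← hiso x hx m hm, ← hiso x hx y hy, ← hiso x hx z hz, ← hiso y hy z hz]
      exact (dist_sq_eq_of_midpoint h1 h2).le
    · obtain ⟨ε, hε, ψ, -, hball, hdist, -⟩ := S.cone_chart q hq
      refine ⟨ε, hε, fun x hx y hy z hz m hm h1 h2 => ?_⟩
      rw [← hball] at hx hy hz hm
      obtain ⟨ρ, α, hρ, hρε, rfl⟩ := hx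
      obtain ⟨r, θ, hr, hrε, rfl⟩ := hy
      obtain ⟨s, φ, hs, hsε, rfl⟩ := hz
      obtain ⟨μ, χ, hμ, hμε, rfl⟩ := hm
      rw [hdist _ _ _ _ hr hrε hμ hμε, hdist _ _ _ _ hr hrε hs hsε] at h1
      rw [hdist _ _ _ _ hμ hμε hs hsε, hdist _ _ _ _ hr hrε hs hsε] at h2
      rw [hdist _ _ _ _ hρ hρε hμ hμε, hdist _ _ _ _ hρ hρε hr hrε, hdist _ _ _ _ hρ hρε hs hsε,
        hdist _ _ _ _ hr hrε hs hsε]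
      exact coneDist_bruhatTits (Nat.succ_pos _) hρ hr hs hμ _ _ _ _ h1 h2
  choose ε hε h using hloc
  obtain ⟨η, hη, hleb⟩ := lebesgue_number_lemma_of_metric (isCompact_univ (X := S.carrier))
    (c := fun q => Metric.ball q (ε q)) (fun q => Metric.isOpen_ball)
    (fun x _ => Set.mem_iUnion.2 ⟨x, Metric.mem_ball_self (hε x)⟩)
  refine ⟨η, hη, fun q x y z m hx hy hz hm => ?_⟩
  obtain ⟨i, hi⟩ := hleb q trivial
  exact h i x (hi hx) y (hi hy) z (hi hz) m (hi hm)

theorem cutAngle_add_pi {m : ℕ} (hm : 0 < m) (θ : ℝ) : cutAngle m θ (θ + π) = π := by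
  have hπ := Real.pi_pos
  have hm1 : (1 : ℝ) ≤ m := by exact_mod_cast hm
  have hp : 0 < 2 * π * (m : ℝ) := by positivity
  rw [cutAngle, show θ - (θ + π) = -π by ring, (AddCircle.norm_coe_eq_abs_iff _ hp.ne').2,
    abs_neg, abs_of_pos hπ, min_self]
  rw [abs_neg, abs_of_pos hπ, abs_of_pos hp]
  nlinarith

theorem TranslationSurface.hasLocalExtensions (S : TranslationSurface.{u}) :
    HasLocalExtensions S.carrier := by
  intro q
  by_cases hq : S.order q = 0
  · obtain ⟨e, ε, hε, hiso, hsurj⟩ := S.exists_disc hq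
    refine ⟨ε, hε, fun w hw0 hwε δ hδ0 hδε => ?_⟩
    have hw : w ∈ Metric.ball q ε := hwε
    have hq' := Metric.mem_ball_self (x := q) hε
    rw [← hiso w hw q hq'] at hw0
    set v : ℂ := e q - e w with hv
    have hv0 : 0 < ‖v‖ := by rwa [hv, ← dist_eq_norm, dist_comm]
    have hdir : dist (e q) (e q + (δ / ‖v‖ : ℝ) • v) = δ := by
      rw [dist_self_add_right, norm_smul, Real.norm_of_nonneg (by positivity),
        div_mul_cancel₀ _ hv0.ne']
    obtain ⟨q', hq'mem, hq'⟩ := hsurj (e q + (δ / ‖v‖ : ℝ) • v) (by rw [dist_comm, hdir]; exact hδε)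
    refine ⟨q', ?_, ?_⟩
    · rw [← hiso q (Metric.mem_ball_self hε) q' hq'mem, hq', hdir]
    · rw [← hiso w hw q' hq'mem, hq', ← hiso w hw q (Metric.mem_ball_self hε), dist_comm (e w),
        dist_comm (e w), dist_eq_norm, dist_eq_norm,
        show e q + (δ / ‖v‖ : ℝ) • v - e w = (1 + δ / ‖v‖ : ℝ) • v by
          rw [add_smul, one_smul, hv]; ring, norm_smul, Real.norm_of_nonneg (by positivity)]
      field_simp
      rfl
  · obtain ⟨ε, hε, ψ, hψ0, hball, hdist, -⟩ := S.cone_chart q hq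
    refine ⟨ε, hε, fun w hw0 hwε δ hδ0 hδε => ?_⟩
    have hw : w ∈ Metric.ball q ε := hwε
    rw [← hball] at hw
    obtain ⟨r, θ, hr, hrε, rfl⟩ := hw
    refine ⟨ψ δ (θ + π), ?_, ?_⟩
    · rw [← hψ0 0, hdist _ _ _ _ le_rfl hε hδ0.le hδε, coneDist_comm,
        coneDist_zero_right _ hδ0.le]
    · rw [hdist _ _ _ _ hr hrε hδ0.le hδε, ← hψ0 0, hdist _ _ _ _ hr hrε le_rfl hε,
        coneDist_zero_right _ hr, coneDist_eq_add _ hr hδ0.le (cutAngle_add_pi (Nat.succ_pos _) θ)]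

end LocalGeometry

/-! ### The area of small balls around cone points -/

section ConeArea

open MeasureTheory

theorem volume_slitDisc (ρ : ℝ) :
    volume (Metric.ball (0 : ℂ) ρ ∩ {z | -z ∈ Complex.slitPlane}) =
      ENNReal.ofReal ρ ^ 2 * ENNReal.ofReal π := by
  have hnull : volume {z : ℂ | -z ∉ Complex.slitPlane} = 0 := by
    have hsub : {z : ℂ | -z ∉ Complex.slitPlane} ⊆ (LinearMap.ker Complex.imLm : Set ℂ) := by
      intro z hz
      rw [Set.mem_ofPred_eq, Complex.mem_slitPlane_iff, not_or, not_not, Complex.neg_im,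
        neg_eq_zero] at hz
      exact hz.2
    refine measure_mono_null hsub (Measure.addHaar_submodule _ _ fun h => ?_)
    have : Complex.I ∈ LinearMap.ker Complex.imLm := by
      rw [h]
      trivial
    simp at this
  have hdiff : Metric.ball (0 : ℂ) ρ ∩ {z | -z ∈ Complex.slitPlane} =
      Metric.ball (0 : ℂ) ρ \ {z : ℂ | -z ∉ Complex.slitPlane} := by
    ext z
    simp
  rw [hdiff, measure_sdiff_null hnull, Complex.volume_ball]
  congr 1
  rw [ENNReal.ofReal, ← NNReal.coe_real_pi, Real.toNNReal_coe]

theorem euclideanHausdorffMeasure_complex : (μHE[2] : Measure ℂ) = volume := by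
  rw [← Complex.finrank_real_complex]
  exact InnerProductSpace.euclideanHausdorffMeasure_eq_volume

theorem le_norm_coe_two_pi_mul_int {k : ℕ} {n : ℤ} (hn : ¬ (k : ℤ) ∣ n) :
    2 * π ≤ ‖((2 * π * n : ℝ) : AddCircle (2 * π * k))‖ := by
  have hπ := Real.pi_pos
  rw [AddCircle.norm_eq]
  set j := round ((2 * π * (k : ℝ))⁻¹ * (2 * π * n))
  rw [show 2 * π * (n : ℝ) - j * (2 * π * k) = 2 * π * ((n - j * k : ℤ) : ℝ) by push_cast; ring,
    abs_mul, abs_of_pos (by positivity : 0 < 2 * π)]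
  refine le_mul_of_one_le_right (by positivity) ?_
  have hne : n - j * k ≠ 0 := fun h => hn ⟨j, by rw [mul_comm]; linarith⟩
  exact_mod_cast Int.one_le_abs hne

theorem exists_polarPoint_eq (z : ℂ) : polarPoint ‖z‖ (Complex.arg (-z) + π) = z := by
  have h := Complex.norm_mul_exp_arg_mul_I (-z)
  rw [norm_neg] at h
  rw [polarPoint, Complex.ofReal_add, add_mul, Complex.exp_add, Complex.exp_pi_mul_I, mul_neg_one,
    mul_neg, h, neg_neg]

/-- A small ball of radius `ρ` around a point of total angle `2πk` contains `k` disjoint open slit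
discs, on each of which polar coordinates define a 1-Lipschitz map onto a slit disc of the plane. -/
theorem TranslationSurface.le_area_ball (S : TranslationSurface.{u}) [MeasurableSpace S.carrier]
    [BorelSpace S.carrier] {p : S.carrier} (hp : S.IsConePoint p) :
    ∃ ε > 0, ∀ ρ, 0 < ρ → ρ ≤ ε → (S.order p + 1 : ℕ) * (ENNReal.ofReal ρ ^ 2 * ENNReal.ofReal π) ≤
      (μHE[2] : Measure S.carrier) (Metric.ball p ρ) := by
  have hπ := Real.pi_pos
  obtain ⟨ε, hε, ψ, hψ0, hball, hdist, -⟩ := S.cone_chart p hp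
  refine ⟨ε, hε, fun ρ hρ hρε => ?_⟩
  set k := S.order p + 1 with hk
  have hrad : ∀ r θ, 0 ≤ r → r < ε → dist (ψ r θ) p = r := by
    intro r θ hr hrε
    rw [← hψ0 0, hdist _ _ _ _ hr hrε le_rfl hε, coneDist_zero_right _ hr]
  set a := ρ / 2 with ha
  have ha0 : 0 < a := by positivity
  have haε : a < ε := by rw [ha]; linarith
  -- the points whose angle to the `j`-th ray is less than `π`
  set A : Fin k → Set S.carrier := fun j =>
    Metric.ball p ρ ∩ {x | dist x (ψ a (2 * π * (j : ℕ) + π)) < dist x p + a} with hA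
  have hAopen : ∀ j, IsOpen (A j) := fun j =>
    Metric.isOpen_ball.inter (isOpen_lt (by fun_prop) (by fun_prop))
  have hAnorm : ∀ j, ∀ r θ, 0 ≤ r → r < ε → ψ r θ ∈ A j →
      ‖((θ - (2 * π * (j : ℕ) + π) : ℝ) : AddCircle (2 * π * k))‖ < π := by
    rintro j r θ hr hrε ⟨-, hlt⟩
    by_contra! hle
    rw [Set.mem_ofPred_eq, hdist _ _ _ _ hr hrε ha0.le haε, hrad r θ hr hrε,
      coneDist_eq_add _ hr ha0.le (min_eq_left hle)] at hlt
    exact lt_irrefl _ hlt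
  have hAdisj : Pairwise (Function.onFun Disjoint A) := by
    intro i j hij
    refine Set.disjoint_left.2 fun x hxi hxj => ?_
    have hx : x ∈ Metric.ball p ε := Metric.ball_subset_ball hρε hxi.1
    rw [← hball] at hx
    obtain ⟨r, θ, hr, hrε, rfl⟩ := hx
    have h1 := hAnorm i r θ hr hrε hxi
    have h2 := hAnorm j r θ hr hrε hxj
    have h3 : 2 * π ≤ ‖((2 * π * ((i : ℕ) - (j : ℕ) : ℤ) : ℝ) : AddCircle (2 * π * k))‖ := by
      refine le_norm_coe_two_pi_mul_int fun hdvd => hij (Fin.ext ?_)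
      have hi := i.2
      have hj := j.2
      have := Int.eq_zero_of_abs_lt_dvd hdvd (by rw [abs_lt]; omega)
      omega
    rw [show 2 * π * (((i : ℕ) - (j : ℕ) : ℤ) : ℝ) = (θ - (2 * π * (j : ℕ) + π)) -
      (θ - (2 * π * (i : ℕ) + π)) by push_cast; ring, AddCircle.coe_sub] at h3
    have h4 := norm_sub_le ((θ - (2 * π * (j : ℕ) + π) : ℝ) : AddCircle (2 * π * k))
      ((θ - (2 * π * (i : ℕ) + π) : ℝ) : AddCircle (2 * π * k))
    linarith
  have hpol : ∀ x ∈ Metric.ball p ε, ∃ r θ, 0 ≤ r ∧ r < ε ∧ ψ r θ = x := fun x hx => by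
    rwa [← hball] at hx
  choose! R Θ hR hRε hRΘ using hpol
  have hlip : LipschitzOnWith 1 (fun x => polarPoint (R x) (Θ x)) (Metric.ball p ε) := by
    refine LipschitzOnWith.of_dist_le_mul fun x hx y hy => ?_
    rw [NNReal.coe_one, one_mul]
    refine (dist_polarPoint_le_coneDist k (hR x hx) (hR y hy) _ _).trans_eq ?_
    rw [← hdist _ _ _ _ (hR x hx) (hRε x hx) (hR y hy) (hRε y hy), hRΘ x hx, hRΘ y hy]
  have hAarea : ∀ j, ENNReal.ofReal ρ ^ 2 * ENNReal.ofReal π ≤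
      (μHE[2] : Measure S.carrier) (A j) := by
    intro j
    have hsub : Metric.ball (0 : ℂ) ρ ∩ {z | -z ∈ Complex.slitPlane} ⊆
        (fun x => polarPoint (R x) (Θ x)) '' A j := by
      rintro z ⟨hz, hzs⟩
      rw [mem_ball_zero_iff] at hz
      have hzε := hz.trans_le hρε
      set θ := Complex.arg (-z) + π + (j : ℕ) * (2 * π) with hθ
      have hx : ψ ‖z‖ θ ∈ Metric.ball p ε := by
        rw [Metric.mem_ball, hrad _ _ (norm_nonneg z) hzε]
        exact hzε
      refine ⟨ψ ‖z‖ θ, ⟨?_, ?_⟩, ?_⟩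
      · rw [Metric.mem_ball, hrad _ _ (norm_nonneg z) hzε]
        exact hz
      · have hz0 : 0 < ‖z‖ := norm_pos_iff.2 fun h => by simp [h] at hzs
        have harg : |Complex.arg (-z)| < π := abs_lt.2 ⟨Complex.neg_pi_lt_arg _,
          (Complex.arg_le_pi _).lt_of_ne (Complex.mem_slitPlane_iff_arg.1 hzs).1⟩
        rw [Set.mem_ofPred_eq, hrad _ _ (norm_nonneg z) hzε,
          hdist _ _ _ _ (norm_nonneg z) hzε ha0.le haε]
        refine lt_of_pow_lt_pow_left₀ 2 (by positivity) ?_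
        rw [coneDist_sq _ (norm_nonneg z) ha0.le]
        have hcut : cutAngle k θ (2 * π * (j : ℕ) + π) < π := by
          refine (min_le_right _ _).trans_lt ?_
          rw [hθ, show Complex.arg (-z) + π + (j : ℕ) * (2 * π) - (2 * π * (j : ℕ) + π) =
            Complex.arg (-z) by ring]
          exact (norm_coe_addCircle_le_abs (by positivity) _).trans_lt harg
        have hcos := Real.cos_lt_cos_of_nonneg_of_le_pi (cutAngle_nonneg _ _ _) le_rfl hcut
        rw [Real.cos_pi] at hcos
        nlinarith [mul_pos hz0 ha0]
      · have hd := dist_polarPoint_le_coneDist k (hR _ hx) (norm_nonneg z) (Θ (ψ ‖z‖ θ)) θ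
        rw [← hdist _ _ _ _ (hR _ hx) (hRε _ hx) (norm_nonneg z) hzε, hRΘ _ hx, dist_self] at hd
        change polarPoint _ _ = z
        rw [dist_le_zero.1 hd, hθ]
        have hper : polarPoint ‖z‖ (Complex.arg (-z) + π + (j : ℕ) * (2 * π)) =
            polarPoint ‖z‖ (Complex.arg (-z) + π) := by
          rw [polarPoint, polarPoint]
          push_cast
          rw [add_mul _ _ Complex.I, mul_assoc ((j : ℕ) : ℂ), Complex.exp_add,
            Complex.exp_nat_mul_two_pi_mul_I, mul_one]
        rw [hper, exists_polarPoint_eq]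
    have h1 := (hlip.mono (Set.inter_subset_left.trans
      (Metric.ball_subset_ball hρε))).euclideanHausdorffMeasure_image_le (s := A j) 2
    rw [ENNReal.coe_one, one_pow, one_mul, euclideanHausdorffMeasure_complex] at h1
    rw [← volume_slitDisc]
    exact (measure_mono hsub).trans h1
  calc (k : ℝ≥0∞) * (ENNReal.ofReal ρ ^ 2 * ENNReal.ofReal π)
      = ∑ _j : Fin k, ENNReal.ofReal ρ ^ 2 * ENNReal.ofReal π := by simp
    _ ≤ ∑ j : Fin k, (μHE[2] : Measure S.carrier) (A j) := Finset.sum_le_sum fun j _ => hAarea j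
    _ = (μHE[2] : Measure S.carrier) (⋃ j, A j) := by
        rw [measure_iUnion hAdisj fun j => (hAopen j).measurableSet, tsum_fintype]
    _ ≤ (μHE[2] : Measure S.carrier) (Metric.ball p ρ) :=
        measure_mono (Set.iUnion_subset fun j => Set.inter_subset_left)

end ConeArea

/-! ### The area estimate -/

/-- The ball of radius `r` around a cone point of angle `2πk` has at least the area `πkr²`, if `2r`
is at most the systole. -/
theorem TranslationSurface.le_area_of_le_sys (S : TranslationSurface.{u}) {p : S.carrier}
    (hp : S.IsConePoint p) {r : ℝ} (hr : 0 < r) (hsys : ENNReal.ofReal (2 * r) ≤ S.sys) :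
    ENNReal.ofReal ((S.order p + 1 : ℕ) * r ^ 2 * π) ≤ S.area := by
  let : MeasurableSpace S.carrier := borel S.carrier
  have : BorelSpace S.carrier := ⟨rfl⟩
  obtain ⟨η, hη0, hη⟩ := S.exists_nonposCurvedAtScale
  have hU := S.uniqueShortestPaths_of_le_sys hη hη0 hsys
  obtain ⟨ε, hε, hcone⟩ := S.le_area_ball hp
  have ht0 : 0 < min 1 (ε / r) := by positivity
  set t : I := ⟨min 1 (ε / r), ht0.le, min_le_left _ _⟩ with ht
  have htr : (t : ℝ) * r ≤ ε := (le_div_iff₀ hr).1 (min_le_right _ _)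
  have h1 := hcone (t * r) (mul_pos ht0 hr) htr
  have h2 := hη.area_ball_mul_le hη0 S.isLengthMetric S.hasLocalExtensions hU p (t := t) ht0
  have h3 := h1.trans h2
  rw [ENNReal.ofReal_mul ht0.le, mul_pow, mul_assoc, mul_left_comm] at h3
  have h4 := (ENNReal.mul_le_mul_iff_right (pow_ne_zero 2 (ENNReal.ofReal_pos.2 ht0).ne')
    (ENNReal.pow_ne_top ENNReal.ofReal_ne_top)).1 h3
  calc ENNReal.ofReal ((S.order p + 1 : ℕ) * r ^ 2 * π)
      = (S.order p + 1 : ℕ) * (ENNReal.ofReal r ^ 2 * ENNReal.ofReal π) := by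
        rw [ENNReal.ofReal_mul (by positivity), ENNReal.ofReal_mul (by positivity),
          ENNReal.ofReal_natCast, ENNReal.ofReal_pow hr.le, mul_assoc]
    _ ≤ (μHE[2] : MeasureTheory.Measure S.carrier) (Metric.ball p r) := h4
    _ ≤ S.area := MeasureTheory.measure_mono (Set.subset_univ _)

/-- The area estimate `area ≥ πk (sys / 2) ^ 2`, rewritten for the systolic ratio. -/
theorem TranslationSurface.systolicRatio_le (S : TranslationSurface.{u}) {p : S.carrier}
    (hp : S.IsConePoint p) :
    S.systolicRatio ≤ ENNReal.ofReal (4 / (π * (S.order p + 1 : ℕ))) := by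
  have hπ := Real.pi_gt_three
  set k := S.order p + 1 with hk
  have hk1 : (1 : ℝ) ≤ k := by
    rw [hk]
    push_cast
    linarith [(Nat.cast_nonneg (S.order p) : (0 : ℝ) ≤ S.order p)]
  rw [systolicRatio]
  by_cases hA : S.area = ⊤
  · simp [hA]
  have hS : S.sys ≠ ⊤ := by
    -- an infinite systole would force an infinite area
    intro hS
    set a := S.area.toReal with ha
    have ha0 : 0 ≤ a := ENNReal.toReal_nonneg
    have := S.le_area_of_le_sys hp (r := a + 1) (by positivity) (by rw [hS]; exact le_top)
    rw [← hk, ENNReal.ofReal_le_iff_le_toReal hA, ← ha] at this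
    nlinarith [mul_le_mul hk1 hπ.le (by norm_num) (by positivity), sq_nonneg a,
      mul_nonneg (by positivity : (0 : ℝ) ≤ a ^ 2 + 2 * a + 1)
        (by nlinarith : 0 ≤ (k : ℝ) * π - 1)]
  rcases eq_or_ne S.sys 0 with h0 | h0
  · simp [h0]
  have hs : 0 < S.sys.toReal := ENNReal.toReal_pos h0 hS
  have harea := S.le_area_of_le_sys hp (r := S.sys.toReal / 2) (by positivity)
    (by rw [mul_div_cancel₀ _ two_ne_zero, ENNReal.ofReal_toReal hS])
  refine ENNReal.div_le_of_le_mul ?_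
  calc S.sys ^ 2 = ENNReal.ofReal (4 / (π * k)) *
        ENNReal.ofReal (k * (S.sys.toReal / 2) ^ 2 * π) := by
        rw [← ENNReal.ofReal_mul (by positivity)]
        nth_rewrite 1 [← ENNReal.ofReal_toReal hS]
        rw [← ENNReal.ofReal_pow hs.le]
        congr 1
        field_simp
        norm_num
    _ ≤ _ := by gcongr

theorem theorem1p4 :
    (∀ (n : ℕ) (K : Fin (n + 1) → ℕ), Monotone K →
      stratumSystolicRatio.{u} K ≤ ENNReal.ofReal (4 / (π * (K (Fin.last n) + 1)))) ∧
    (∀ (S : TranslationSurface.{u}) (p : S.carrier) (k : ℕ),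
      S.IsConePoint p → S.coneAngle p = 2 * π * k →
        S.systolicRatio ≤ ENNReal.ofReal (4 / (π * k))) := by
  refine ⟨fun n K _ => iSup₂_le fun S hS => ?_, fun S p k hp hk => ?_⟩
  · obtain ⟨p, hp⟩ := hS
    have := S.systolicRatio_le (p (Fin.last n)).2
    rw [hp] at this
    exact_mod_cast this
  · have hk' : (S.order p + 1 : ℕ) = k := by
      rw [TranslationSurface.coneAngle] at hk
      exact_mod_cast mul_left_cancel₀ (by positivity) hk
    rw [← hk']
    exact S.systolicRatio_le hp
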